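/- Regard $\mathbb S^3$ as the unit quaternions, write tangent vectors of $\mathbb S^3\times\mathbb S^3$ at $(p,q)$ as $Z=(U,V)$ with $U\in T_p\mathbb S^3$, $V\in T_q\mathbb S^3$, and set $$JZ=\tfrac1{\sqrt3}(2pq^{-1}V-U,\,-2qp^{-1}U+V),\qquad g(Z,Z')=\tfrac12\big(\langle Z,Z'\rangle+\langle JZ,JZ'\rangle\big),\qquad PZ=(pq^{-1}V,\,qp^{-1}U),$$ where $\langle\cdot,\cdot\rangle$ is the standard product metric. Then $(\mathbb S^3\times\mathbb S^3,g,J)$ is the homogeneous nearly Kähler $\mathbb S^3\times\mathbb S^3$. Let $\tilde\nabla$ be the Levi-Civita connection of $g$ and $G(X,Y)=(\tilde\nabla_XJ)Y$. Let $M$ be a smooth $3$-manifold, smoothly immersed in $\mathbb S^3\times\mathbb S^3$ as a Lagrangian submanifold, i.e. $JTM=T^\perp M$. Tangent vectors of $M$ are identified with their images, and $\nabla$, $\nabla^\perp$, $h$, $R$, $R^\perp$ denote the induced connection, the normal connection, the second fundamental form, and the curvature tensors of $\nabla$ and $\nabla^\perp$ (with $R(X,Y)=\nabla_X\nabla_Y-\nabla_Y\nabla_X-\nabla_{[X,Y]}$,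 and similarly for $R^\perp$); put $(\nabla h)(X,Y,Z)=\nabla^\perp_Xh(Y,Z)-h(\nabla_XY,Z)-h(Y,\nabla_XZ)$. Suppose that $M$ is $J$-isotropic: there is a function $\lambda:M\to\mathbb R$ with $$g((\nabla h)(v,v,v),Jv)=\lambda\,(g(v,v))^2\qquad\text{for all } v\in TM.$$ Then $\lambda$ is smooth, and for all tangent vectors $X,Y,Z,W,V$ of $M$ at the same point $$\begin{aligned} &12\,g\big(R^\perp(X,Y)h(Z,W)-h(R(X,Y)Z,W)-h(Z,R(X,Y)W),JV\big)\\ &+9\big[g((\nabla h)(Y,Z,W),G(X,V))-g((\nabla h)(X,Z,W),G(Y,V))\big]\\ &+3g(h(Y,Z),JW)g(X,V)-3g(h(X,Z),JW)g(Y,V)\\ &+\mathop{\mathfrak S}_{ZW}\Big[g(h(X,Z),JV)g(Y,W)-g(h(Y,Z),JV)g(X,W)\\ &\qquad+g(PY,Z)g(PX,G(W,V))-g(PX,Z)g(PY,G(W,V))\\ &\qquad+g(JPY,Z)g(JPX,G(W,V))-g(JPX,Z)g(JPY,G(W,V))\Big]\\ &+2\,\mathbf I(X,Y,Z,W,V)=0,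 \end{aligned}$$ where $$\begin{aligned} \mathbf I(X,Y,Z,W,V)=\mathop{\mathfrak S}_{ZWV}\Big[&g(PY,h(X,Z))g(PJW,V)+g((\tilde\nabla_XP)Y+Ph(X,Y),Z)g(PJW,V)\\ &+g(PY,Z)g(PJW,h(X,V))+g(PY,Z)g((\tilde\nabla_XPJ)W+PJh(X,W),V)\\ &-g(PX,h(Y,Z))g(PJW,V)-g((\tilde\nabla_YP)X+Ph(X,Y),Z)g(PJW,V)\\ &-g(PX,Z)g(PJW,h(Y,V))-g(PX,Z)g((\tilde\nabla_YPJ)W+PJh(Y,W),V)\\ &-g(PJY,h(X,Z))g(PW,V)-g((\tilde\nabla_XPJ)Y+PJh(X,Y),Z)g(PW,V)\\ &-g(PJY,Z)g(PW,h(X,V))-g(PJY,Z)g((\tilde\nabla_XP)W+Ph(X,W),V)\\ &+g(PJX,h(Y,Z))g(PW,V)+g((\tilde\nabla_YPJ)X+PJh(X,Y),Z)g(PW,V)\\ &+g(PJX,Z)g(PW,h(Y,V))+g(PJX,Z)g((\tilde\nabla_YP)W+Ph(Y,W),V)\\ &-2X(\lambda)g(Y,Z)g(W,V)+2Y(\lambda)g(X,Z)g(W,V)\Big].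 \end{aligned}$$ Here $\mathfrak S_{ZWV}$ and $\mathfrak S_{ZW}$ denote cyclic sums, that is $\mathfrak S_{ZWV}F(Z,W,V)=F(Z,W,V)+F(W,V,Z)+F(V,Z,W)$ and $\mathfrak S_{ZW}F(Z,W)=F(Z,W)+F(W,Z)$, and $\tilde\nabla_XPJ$ is the covariant derivative of the endomorphism field $PJ$. -/

import Mathlib

open scoped Manifold ContDiff Quaternion

noncomputable section

/-- `ℍ × ℍ`, in which `𝕊³ × 𝕊³` (pairs of unit quaternions) sits. Its norm is only used as a
topology and for derivatives. -/
abbrev HH : Type := ℍ[ℝ] × ℍ[ℝ]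

/-- The model space of a 3-dimensional manifold. -/
abbrev E3 : Type := EuclideanSpace ℝ (Fin 3)

instance finrankQuaternionFact : Fact (Module.finrank ℝ ℍ[ℝ] = 3 + 1) :=
  ⟨Quaternion.finrank_eq_four⟩

/-- The 3-sphere of unit quaternions. -/
abbrev S3 : Type := Metric.sphere (0 : ℍ[ℝ]) 1

namespace NK

/-! ### The nearly Kähler structure on `𝕊³ × 𝕊³`

A point is `x = (p, q)`, a tangent vector at `x` is `w = (U, V) ∈ ℍ × ℍ` with `U ⟂ p`, `V ⟂ q`. -/

/-- `x` is a point of `𝕊³ × 𝕊³`. -/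
def OnS (x : HH) : Prop := ‖x.1‖ = 1 ∧ ‖x.2‖ = 1

/-- `w` is tangent to `𝕊³ × 𝕊³` at `x`. -/
def IsTangent (x w : HH) : Prop := inner ℝ x.1 w.1 = 0 ∧ inner ℝ x.2 w.2 = 0

/-- The almost complex structure `J (U, V) = 1/√3 (2 p q⁻¹ V - U, -2 q p⁻¹ U + V)`. -/
def J (x w : HH) : HH :=
  ((1 / √3 : ℝ) • ((2 : ℝ) • (x.1 * x.2⁻¹ * w.2) - w.1),
   (1 / √3 : ℝ) • (-((2 : ℝ) • (x.2 * x.1⁻¹ * w.1)) + w.2))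

/-- The product metric `⟨·,·⟩`. -/
def prodInner (w w' : HH) : ℝ := inner ℝ w.1 w'.1 + inner ℝ w.2 w'.2

/-- The nearly Kähler metric `g(Z, Z') = (⟨Z, Z'⟩ + ⟨J Z, J Z'⟩) / 2`. -/
def g (x w w' : HH) : ℝ := 1 / 2 * (prodInner w w' + prodInner (J x w) (J x w'))

/-- The almost product structure `P (U, V) = (p q⁻¹ V, q p⁻¹ U)`. -/
def P (x w : HH) : HH := (x.1 * x.2⁻¹ * w.2, x.2 * x.1⁻¹ * w.1)

/-- The composition `P J`. -/
def PJ (x w : HH) : HH := P x (J x w)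

/-- Orthogonal projection (for the product metric) onto the tangent space of `𝕊³ × 𝕊³` at `x`. -/
def tanProj (x w : HH) : HH :=
  (w.1 - (inner ℝ x.1 w.1 : ℝ) • x.1, w.2 - (inner ℝ x.2 w.2 : ℝ) • x.2)

/-- The difference tensor between the Levi-Civita connections of `g` and of the product metric:
with `X = (p a, q b)`, `Y = (p α, q β)` and `n = [a, β] - [b, α]` it is `(-p n / 6, q n / 6)`. -/
def diffTensor (x X Y : HH) : HH :=
  let a := x.1⁻¹ * X.1
  let b := x.2⁻¹ * X.2
  let α := x.1⁻¹ * Y.1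
  let β := x.2⁻¹ * Y.2
  let n := (a * β - β * a) - (b * α - α * b)
  (-((1 / 6 : ℝ) • (x.1 * n)), (1 / 6 : ℝ) • (x.2 * n))

/-- The Levi-Civita connection `∇̃` of `(𝕊³ × 𝕊³, g)`, acting on vector fields along maps.
For `u : E → ℍ × ℍ` with values in `𝕊³ × 𝕊³` and a field `ξ` of vectors tangent to `𝕊³ × 𝕊³` along
`u`, `nabla u ξ t X` is `∇̃_X ξ` at `t`. The theorems `isTangent_nabla`, `fderiv_g_eq` and
`nabla_torsionFree` below say that its values are tangent, that it is compatible with `g`, and that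
it is torsion free; for a parametrization `u` of `𝕊³ × 𝕊³` this characterizes `∇̃`. -/
def nabla {E : Type*} [NormedAddCommGroup E] [NormedSpace ℝ E]
    (u ξ : E → HH) (t X : E) : HH :=
  tanProj (u t) (fderiv ℝ ξ t X) + diffTensor (u t) (fderiv ℝ u t X) (ξ t)

/-! ### `nabla` is the Levi-Civita connection -/

theorem inv_eq_star {a : ℍ[ℝ]} (h : ‖a‖ = 1) : a⁻¹ = star a := by
  have h2 : Quaternion.normSq a = 1 := by
    rw [Quaternion.normSq_eq_norm_mul_self, h]; norm_num
  rw [Quaternion.inv_def, h2]; simp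

theorem star_mul_self_of {a : ℍ[ℝ]} (h : ‖a‖ = 1) : star a * a = 1 := by
  have h2 : Quaternion.normSq a = 1 := by
    rw [Quaternion.normSq_eq_norm_mul_self, h]; norm_num
  rw [Quaternion.star_mul_self, h2]; simp

theorem self_mul_star_of {a : ℍ[ℝ]} (h : ‖a‖ = 1) : a * star a = 1 := by
  have h2 : Quaternion.normSq a = 1 := by
    rw [Quaternion.normSq_eq_norm_mul_self, h]; norm_num
  rw [Quaternion.self_mul_star, h2]; simp

theorem inner_comp (a b : ℍ[ℝ]) :
    (inner ℝ a b : ℝ) = a.re * b.re + a.imI * b.imI + a.imJ * b.imJ + a.imK * b.imK := by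
  rw [Quaternion.inner_def]; simp [Quaternion.re_mul]

theorem inner_mul_left_of {p : ℍ[ℝ]} (h : ‖p‖ = 1) (x y : ℍ[ℝ]) :
    (inner ℝ (p * x) (p * y) : ℝ) = inner ℝ x y := by
  have h2 : p.re ^ 2 + p.imI ^ 2 + p.imJ ^ 2 + p.imK ^ 2 = 1 := by
    rw [← Quaternion.normSq_def', Quaternion.normSq_eq_norm_mul_self, h]; norm_num
  simp only [inner_comp, Quaternion.re_mul, Quaternion.imI_mul, Quaternion.imJ_mul,
    Quaternion.imK_mul]
  linear_combination (x.re * y.re + x.imI * y.imI + x.imJ * y.imJ + x.imK * y.imK) * h2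

theorem exists_eq_mul {p : ℍ[ℝ]} (h : ‖p‖ = 1) (w : ℍ[ℝ]) : ∃ a, w = p * a :=
  ⟨star p * w, by rw [← mul_assoc, self_mul_star_of h, one_mul]⟩

theorem star_mul_mul {p : ℍ[ℝ]} (h : ‖p‖ = 1) (a : ℍ[ℝ]) : star p * (p * a) = a := by
  rw [← mul_assoc, star_mul_self_of h, one_mul]

/-- The metric `g` on `𝕊³ × 𝕊³` in terms of the product metric. -/
theorem g_eq {x : HH} (hx : OnS x) (w w' : HH) :
    g x w w' = 4 / 3 * prodInner w w' -
      2 / 3 * (inner ℝ (star x.1 * w.1) (star x.2 * w'.2) +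
        inner ℝ (star x.1 * w'.1) (star x.2 * w.2)) := by
  obtain ⟨p, q⟩ := x
  obtain ⟨U, V⟩ := w
  obtain ⟨U', V'⟩ := w'
  obtain ⟨hp, hq⟩ := hx
  simp only at hp hq
  obtain ⟨a, rfl⟩ := exists_eq_mul hp U
  obtain ⟨b, rfl⟩ := exists_eq_mul hq V
  obtain ⟨a', rfl⟩ := exists_eq_mul hp U'
  obtain ⟨b', rfl⟩ := exists_eq_mul hq V'
  have hs : (1 / √3 : ℝ) * (1 / √3) = 1 / 3 := by
    rw [div_mul_div_comm, Real.mul_self_sqrt (by norm_num)]; norm_num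
  simp only [g, J, prodInner, inv_eq_star hp, inv_eq_star hq, mul_assoc, star_mul_mul hp,
    star_mul_mul hq, ← mul_smul_comm, ← mul_sub, ← mul_neg, ← mul_add, inner_mul_left_of hp,
    inner_mul_left_of hq]
  generalize (1 / √3 : ℝ) = s at hs
  simp only [inner_comp, Quaternion.re_smul, Quaternion.imI_smul, Quaternion.imJ_smul,
    Quaternion.imK_smul, Quaternion.re_sub, Quaternion.imI_sub, Quaternion.imJ_sub,
    Quaternion.imK_sub, Quaternion.re_add, Quaternion.imI_add, Quaternion.imJ_add,
    Quaternion.imK_add, Quaternion.re_neg, Quaternion.imI_neg, Quaternion.imJ_neg,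
    Quaternion.imK_neg, smul_eq_mul]
  linear_combination (1 / 2 *
    ((2 * b.re - a.re) * (2 * b'.re - a'.re) + (2 * b.imI - a.imI) * (2 * b'.imI - a'.imI) +
      (2 * b.imJ - a.imJ) * (2 * b'.imJ - a'.imJ) + (2 * b.imK - a.imK) * (2 * b'.imK - a'.imK) +
      (b.re - 2 * a.re) * (b'.re - 2 * a'.re) + (b.imI - 2 * a.imI) * (b'.imI - 2 * a'.imI) +
      (b.imJ - 2 * a.imJ) * (b'.imJ - 2 * a'.imJ) +
      (b.imK - 2 * a.imK) * (b'.imK - 2 * a'.imK))) * hs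

theorem fderiv_tangent {E : Type*} [NormedAddCommGroup E] [NormedSpace ℝ E]
    {u ξ : E → ℍ[ℝ]} {t : E} (hu : DifferentiableAt ℝ u t) (hξ : DifferentiableAt ℝ ξ t)
    {c : ℝ} (h : ∀ᶠ s in nhds t, (inner ℝ (u s) (ξ s) : ℝ) = c) (X : E) :
    (inner ℝ (u t) (fderiv ℝ ξ t X) : ℝ) + inner ℝ (fderiv ℝ u t X) (ξ t) = 0 := by
  rw [← fderiv_inner_apply ℝ hu hξ]
  have : (fun s => (inner ℝ (u s) (ξ s) : ℝ)) =ᶠ[nhds t] fun _ => c := h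
  rw [this.fderiv_eq]
  simp

theorem fderiv_onS {E : Type*} [NormedAddCommGroup E] [NormedSpace ℝ E]
    {u : E → HH} {t : E} (hu : DifferentiableAt ℝ u t) (hS : ∀ᶠ s in nhds t, OnS (u s)) (X : E) :
    IsTangent (u t) (fderiv ℝ u t X) := by
  have h1 := fderiv_tangent (u := fun s => (u s).1) (ξ := fun s => (u s).1) hu.fst hu.fst (c := 1)
    (hS.mono fun s hs => by simp [hs.1]) X
  have h2 := fderiv_tangent (u := fun s => (u s).2) (ξ := fun s => (u s).2) hu.snd hu.snd (c := 1)
    (hS.mono fun s hs => by simp [hs.2]) X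
  rw [real_inner_comm _ (fderiv ℝ _ t X)] at h1 h2
  rw [fderiv.fst hu] at h1
  rw [fderiv.snd hu] at h2
  simp only [ContinuousLinearMap.comp_apply, ContinuousLinearMap.coe_fst',
    ContinuousLinearMap.coe_snd'] at h1 h2
  exact ⟨by linarith, by linarith⟩

theorem re_of_tangent {p a : ℍ[ℝ]} (hp : ‖p‖ = 1) (h : (inner ℝ p (p * a) : ℝ) = 0) :
    a.re = 0 := by
  have := inner_mul_left_of hp 1 a
  rw [mul_one, h, inner_comp] at this
  simpa using this.symm

theorem tanProj_mul {p q : ℍ[ℝ]} (hp : ‖p‖ = 1) (hq : ‖q‖ = 1) (A B : ℍ[ℝ]) :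
    tanProj (p, q) (p * A, q * B) = (p * (A - (A.re : ℍ[ℝ])), q * (B - (B.re : ℍ[ℝ]))) := by
  have h1 := inner_mul_left_of hp 1 A
  have h2 := inner_mul_left_of hq 1 B
  rw [mul_one] at h1 h2
  simp only [tanProj, h1, h2, mul_sub]
  simp [inner_comp, Quaternion.mul_coe_eq_smul]

theorem diffTensor_mul {p q : ℍ[ℝ]} (hp : ‖p‖ = 1) (hq : ‖q‖ = 1) (a b α β : ℍ[ℝ]) :
    diffTensor (p, q) (p * a, q * b) (p * α, q * β) =
      (p * (-((1 / 6 : ℝ) • ((a * β - β * a) - (b * α - α * b)))),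
        q * ((1 / 6 : ℝ) • ((a * β - β * a) - (b * α - α * b)))) := by
  simp only [diffTensor, inv_eq_star hp, inv_eq_star hq, star_mul_mul hp, star_mul_mul hq,
    mul_smul_comm, mul_neg]

/-- The values of `nabla` are tangent to `𝕊³ × 𝕊³`. -/
theorem isTangent_nabla {E : Type*} [NormedAddCommGroup E] [NormedSpace ℝ E]
    (u ξ : E → HH) (t X : E) (hS : OnS (u t)) : IsTangent (u t) (nabla u ξ t X) := by
  unfold nabla
  generalize u t = x at *
  generalize fderiv ℝ u t X = U at *
  generalize ξ t = w at *
  generalize fderiv ℝ ξ t X = A at *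
  obtain ⟨p, q⟩ := x
  obtain ⟨U, V⟩ := U
  obtain ⟨w, z⟩ := w
  obtain ⟨A, B⟩ := A
  obtain ⟨hp, hq⟩ := hS
  simp only at hp hq
  obtain ⟨a, rfl⟩ := exists_eq_mul hp U
  obtain ⟨b, rfl⟩ := exists_eq_mul hq V
  obtain ⟨α, rfl⟩ := exists_eq_mul hp w
  obtain ⟨β, rfl⟩ := exists_eq_mul hq z
  obtain ⟨A, rfl⟩ := exists_eq_mul hp A
  obtain ⟨B, rfl⟩ := exists_eq_mul hq B
  rw [tanProj_mul hp hq, diffTensor_mul hp hq]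
  simp only [IsTangent, Prod.fst_add, Prod.snd_add, ← mul_add]
  constructor
  · have h1 := inner_mul_left_of hp 1
    rw [mul_one] at h1
    rw [h1, inner_comp]
    simp
    ring
  · have h1 := inner_mul_left_of hq 1
    rw [mul_one] at h1
    rw [h1, inner_comp]
    simp
    ring

/-- `nabla` is torsion free: for a map `u` into `𝕊³ × 𝕊³`, the fields `∂_X u` and `∂_Y u` satisfy
`∇̃_X ∂_Y u = ∇̃_Y ∂_X u`. -/
theorem nabla_torsionFree {E : Type*} [NormedAddCommGroup E] [NormedSpace ℝ E]
    {u : E → HH} {t : E} (hu : ContDiffAt ℝ 2 u t) (X Y : E) :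
    nabla u (fun s => fderiv ℝ u s Y) t X = nabla u (fun s => fderiv ℝ u s X) t Y := by
  have hd : DifferentiableAt ℝ (fderiv ℝ u) t :=
    (hu.fderiv_right (m := 1) (by norm_num)).differentiableAt (by norm_num)
  have hs : fderiv ℝ (fun s => fderiv ℝ u s Y) t X = fderiv ℝ (fun s => fderiv ℝ u s X) t Y := by
    rw [fderiv_clm_apply hd (differentiableAt_const _), fderiv_clm_apply hd
      (differentiableAt_const _)]
    simpa using (hu.isSymmSndFDerivAt (by simp)) X Y
  simp only [nabla, hs, diffTensor]
  congr 2 <;> abel_nf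

/-- `nabla` is compatible with the metric `g`. -/
theorem fderiv_g_eq {E : Type*} [NormedAddCommGroup E] [NormedSpace ℝ E]
    {u ξ η : E → HH} {t : E} (hu : DifferentiableAt ℝ u t) (hξ : DifferentiableAt ℝ ξ t)
    (hη : DifferentiableAt ℝ η t) (hS : ∀ᶠ s in nhds t, OnS (u s))
    (hξT : ∀ᶠ s in nhds t, IsTangent (u s) (ξ s)) (hηT : ∀ᶠ s in nhds t, IsTangent (u s) (η s))
    (X : E) :
    fderiv ℝ (fun s => g (u s) (ξ s) (η s)) t X =
      g (u t) (nabla u ξ t X) (η t) + g (u t) (ξ t) (nabla u η t X) := by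
  have hU := fderiv_onS hu hS X
  have e : (fun s => g (u s) (ξ s) (η s)) =ᶠ[nhds t] fun s =>
      4 / 3 * (inner ℝ (ξ s).1 (η s).1 + inner ℝ (ξ s).2 (η s).2) -
      2 / 3 * (inner ℝ (star (u s).1 * (ξ s).1) (star (u s).2 * (η s).2) +
        inner ℝ (star (u s).1 * (η s).1) (star (u s).2 * (ξ s).2)) :=
    hS.mono fun s hs => g_eq hs _ _
  rw [e.fderiv_eq]
  have d : ∀ {f : E → HH}, DifferentiableAt ℝ f t →
      HasFDerivAt (fun s => (f s).1) ((ContinuousLinearMap.fst ℝ _ _).comp (fderiv ℝ f t)) t ∧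
      HasFDerivAt (fun s => (f s).2) ((ContinuousLinearMap.snd ℝ _ _).comp (fderiv ℝ f t)) t :=
    fun hf => ⟨hf.hasFDerivAt.fst, hf.hasFDerivAt.snd⟩
  obtain ⟨u1, u2⟩ := d hu
  obtain ⟨x1, x2⟩ := d hξ
  obtain ⟨y1, y2⟩ := d hη
  let S : ℍ[ℝ] →L[ℝ] ℍ[ℝ] := LinearMap.toContinuousLinearMap
    { toFun := star, map_add' := star_add, map_smul' := fun r x => by ext <;> simp }
  have v1 : HasFDerivAt (fun s => star (u s).1) _ t := S.hasFDerivAt.comp t u1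
  have v2 : HasFDerivAt (fun s => star (u s).2) _ t := S.hasFDerivAt.comp t u2
  have D := (((x1.inner ℝ y1).add (x2.inner ℝ y2)).const_mul (4 / 3)).sub
    ((((v1.mul' x1).inner ℝ (v2.mul' y2)).add
      ((v1.mul' y1).inner ℝ (v2.mul' x2))).const_mul (2 / 3))
  rw [show fderiv ℝ (fun s => 4 / 3 * (inner ℝ (ξ s).1 (η s).1 + inner ℝ (ξ s).2 (η s).2) -
      2 / 3 * (inner ℝ (star (u s).1 * (ξ s).1) (star (u s).2 * (η s).2) +
        inner ℝ (star (u s).1 * (η s).1) (star (u s).2 * (ξ s).2))) t = _ from D.fderiv]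
  have hS' := hS.self_of_nhds
  have hξ' := hξT.self_of_nhds
  have hη' := hηT.self_of_nhds
  rw [g_eq hS', g_eq hS']
  have hSa : ∀ x, S x = star x := fun _ => rfl
  simp [hSa]
  simp only [nabla]
  clear D v1 v2 u1 u2 x1 x2 y1 y2 d e hS hξT hηT hSa
  generalize fderiv ℝ u t X = U at *
  generalize fderiv ℝ ξ t X = A at *
  generalize fderiv ℝ η t X = A' at *
  generalize ξ t = w at *
  generalize η t = w' at *
  generalize u t = x at *
  obtain ⟨p, q⟩ := x
  obtain ⟨U, V⟩ := U
  obtain ⟨w, z⟩ := w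
  obtain ⟨w', z'⟩ := w'
  obtain ⟨A, B⟩ := A
  obtain ⟨A', B'⟩ := A'
  obtain ⟨hp, hq⟩ := hS'
  simp only [IsTangent] at *
  obtain ⟨a, rfl⟩ := exists_eq_mul hp U
  obtain ⟨b, rfl⟩ := exists_eq_mul hq V
  obtain ⟨α, rfl⟩ := exists_eq_mul hp w
  obtain ⟨β, rfl⟩ := exists_eq_mul hq z
  obtain ⟨α', rfl⟩ := exists_eq_mul hp w'
  obtain ⟨β', rfl⟩ := exists_eq_mul hq z'
  obtain ⟨A, rfl⟩ := exists_eq_mul hp A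
  obtain ⟨B, rfl⟩ := exists_eq_mul hq B
  obtain ⟨A', rfl⟩ := exists_eq_mul hp A'
  obtain ⟨B', rfl⟩ := exists_eq_mul hq B'
  have r1 := re_of_tangent hp hU.1
  have r2 := re_of_tangent hq hU.2
  have r3 := re_of_tangent hp hξ'.1
  have r4 := re_of_tangent hq hξ'.2
  have r5 := re_of_tangent hp hη'.1
  have r6 := re_of_tangent hq hη'.2
  have s1 : ∀ x y : ℍ[ℝ], star (p * x) * (p * y) = star x * y := fun x y => by
    rw [star_mul, mul_assoc, star_mul_mul hp]
  have s2 : ∀ x y : ℍ[ℝ], star (q * x) * (q * y) = star x * y := fun x y => by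
    rw [star_mul, mul_assoc, star_mul_mul hq]
  rw [tanProj_mul hp hq, diffTensor_mul hp hq, tanProj_mul hp hq, diffTensor_mul hp hq]
  simp only [prodInner, Prod.fst_add, Prod.snd_add, ← mul_add, star_mul_mul hp, star_mul_mul hq,
    inner_mul_left_of hp, inner_mul_left_of hq, s1, s2]
  clear s1 s2 hU hξ' hη' hp hq
  simp [inner_comp, r1, r2, r3, r4, r5, r6]
  ring

/-! ### Covariant derivatives of tensor fields on `𝕊³ × 𝕊³` -/

/-- The left-invariant vector field on `𝕊³ × 𝕊³` with value `Y` at `x`. -/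
def leftExt (x Y y : HH) : HH := (y.1 * x.1⁻¹ * Y.1, y.2 * x.2⁻¹ * Y.2)

/-- The covariant derivative `(∇̃_X T) Y = ∇̃_X (T Y) - T (∇̃_X Y)` at `x ∈ 𝕊³ × 𝕊³` of a field `T`
of endomorphisms, for tangent vectors `X`, `Y` at `x` (`Y` is extended to a vector field; the result
does not depend on the extension). -/
def covDeriv (T : HH → HH → HH) (x X Y : HH) : HH :=
  nabla (fun y => y) (fun y => T y (leftExt x Y y)) x X -
    T x (nabla (fun y => y) (leftExt x Y) x X)

/-- The tensor `G = ∇̃ J`, that is `G(X, Y) = (∇̃_X J) Y`. -/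
def G (x X Y : HH) : HH := covDeriv J x X Y

/-! ### Immersed 3-dimensional submanifolds in local coordinates

Here `u : E3 → ℍ × ℍ` is (on an open set) a local parametrization of a submanifold of `𝕊³ × 𝕊³`,
`t` is a point of the coordinate domain, and tangent vectors of the submanifold at `t` are given by
their coordinate vectors in `E3`; `X` corresponds to the vector `fderiv ℝ u t X` in `ℍ × ℍ`. All
tensors are evaluated on vectors by extending these to fields with constant coordinates, whose
brackets vanish. -/

/-- The coordinate vectors. -/
def coordVec (i : Fin 3) : E3 := EuclideanSpace.single i 1

/-- The Gram matrix `g_ij = g(∂_i u, ∂_j u)` of the induced metric. -/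
def gram (u : E3 → HH) (t : E3) : Matrix (Fin 3) (Fin 3) ℝ :=
  Matrix.of fun i j => g (u t) (fderiv ℝ u t (coordVec i)) (fderiv ℝ u t (coordVec j))

/-- The coordinate vector of the `g`-orthogonal projection of `w` onto the tangent space of the
submanifold: its `i`-th coordinate is `∑ j, g^ij g(w, ∂_j u)`. -/
def tang (u : E3 → HH) (t : E3) (w : HH) : E3 :=
  WithLp.toLp 2 fun i => ∑ j, (gram u t)⁻¹ i j * g (u t) w (fderiv ℝ u t (coordVec j))

/-- The normal component of `w`. -/
def nor (u : E3 → HH) (t : E3) (w : HH) : HH := w - fderiv ℝ u t (tang u t w)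

/-- The induced connection: `∇_X Y` at `t`, the tangent part of `∇̃_X Y`, for a vector field `Y`. -/
def conn (u : E3 → HH) (Y : E3 → E3) (t X : E3) : E3 :=
  tang u t (nabla u (fun s => fderiv ℝ u s (Y s)) t X)

/-- The second fundamental form `h(X, Y)`, the normal part of `∇̃_X Y`. -/
def h (u : E3 → HH) (t X Y : E3) : HH :=
  nor u t (nabla u (fun s => fderiv ℝ u s Y) t X)

/-- The normal connection: `∇^⊥_X ξ` at `t`, the normal part of `∇̃_X ξ`, for a normal field `ξ`. -/
def normalConn (u : E3 → HH) (ξ : E3 → HH) (t X : E3) : HH := nor u t (nabla u ξ t X)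

/-- `(∇h)(X, Y, Z) = ∇^⊥_X h(Y, Z) - h(∇_X Y, Z) - h(Y, ∇_X Z)`. -/
def nablaH (u : E3 → HH) (t X Y Z : E3) : HH :=
  normalConn u (fun s => h u s Y Z) t X - h u t (conn u (fun _ => Y) t X) Z -
    h u t Y (conn u (fun _ => Z) t X)

/-- The curvature tensor `R(X, Y) Z = ∇_X ∇_Y Z - ∇_Y ∇_X Z - ∇_[X,Y] Z` of the induced connection
(`[X, Y] = 0` for the fields with constant coordinates). -/
def curv (u : E3 → HH) (t X Y Z : E3) : E3 :=
  conn u (fun s => conn u (fun _ => Z) s Y) t X - conn u (fun s => conn u (fun _ => Z) s X) t Y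

/-- The normal curvature `R^⊥(X, Y) ξ = ∇^⊥_X ∇^⊥_Y ξ - ∇^⊥_Y ∇^⊥_X ξ - ∇^⊥_[X,Y] ξ` at `t`, for a
normal field `ξ` (`[X, Y] = 0` for the fields with constant coordinates). -/
def normalCurv (u : E3 → HH) (ξ : E3 → HH) (t X Y : E3) : HH :=
  normalConn u (fun s => normalConn u ξ s Y) t X - normalConn u (fun s => normalConn u ξ s X) t Y

/-- The cyclic sum over two arguments. -/
def cyc2 (F : E3 → E3 → ℝ) (Z W : E3) : ℝ := F Z W + F W Z

/-- The cyclic sum over three arguments. -/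
def cyc3 (F : E3 → E3 → E3 → ℝ) (Z W V : E3) : ℝ := F Z W V + F W V Z + F V Z W

/-- The expression `I(X, Y, Z, W, V)`; `l` is the coordinate expression of the function `λ`. -/
def termI (u : E3 → HH) (l : E3 → ℝ) (t X Y Z W V : E3) : ℝ :=
  let x := u t
  let d := fun A : E3 => fderiv ℝ u t A
  let h' := h u t
  let DP := fun A B : E3 => covDeriv P x (d A) (d B)
  let DPJ := fun A B : E3 => covDeriv PJ x (d A) (d B)
  cyc3 (fun Z W V =>
    g x (P x (d Y)) (h' X Z) * g x (PJ x (d W)) (d V)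
    + g x (DP X Y + P x (h' X Y)) (d Z) * g x (PJ x (d W)) (d V)
    + g x (P x (d Y)) (d Z) * g x (PJ x (d W)) (h' X V)
    + g x (P x (d Y)) (d Z) * g x (DPJ X W + PJ x (h' X W)) (d V)
    - g x (P x (d X)) (h' Y Z) * g x (PJ x (d W)) (d V)
    - g x (DP Y X + P x (h' X Y)) (d Z) * g x (PJ x (d W)) (d V)
    - g x (P x (d X)) (d Z) * g x (PJ x (d W)) (h' Y V)
    - g x (P x (d X)) (d Z) * g x (DPJ Y W + PJ x (h' Y W)) (d V)
    - g x (PJ x (d Y)) (h' X Z) * g x (P x (d W)) (d V)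
    - g x (DPJ X Y + PJ x (h' X Y)) (d Z) * g x (P x (d W)) (d V)
    - g x (PJ x (d Y)) (d Z) * g x (P x (d W)) (h' X V)
    - g x (PJ x (d Y)) (d Z) * g x (DP X W + P x (h' X W)) (d V)
    + g x (PJ x (d X)) (h' Y Z) * g x (P x (d W)) (d V)
    + g x (DPJ Y X + PJ x (h' X Y)) (d Z) * g x (P x (d W)) (d V)
    + g x (PJ x (d X)) (d Z) * g x (P x (d W)) (h' Y V)
    + g x (PJ x (d X)) (d Z) * g x (DP Y W + P x (h' Y W)) (d V)
    - 2 * fderiv ℝ l t X * g x (d Y) (d Z) * g x (d W) (d V)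
    + 2 * fderiv ℝ l t Y * g x (d X) (d Z) * g x (d W) (d V)) Z W V

/-! ### Lagrangian and `J`-isotropic immersions -/

section Immersions

variable {M : Type*} [TopologicalSpace M] [ChartedSpace E3 M]

/-- A map to `𝕊³ × 𝕊³`, seen as a map to `ℍ × ℍ`. -/
def toHH (f : M → S3 × S3) (p : M) : HH := ((f p).1, (f p).2)

/-- `f` is a smooth immersion of the 3-manifold `M` in `𝕊³ × 𝕊³`. -/
def IsSmoothImmersion (f : M → S3 × S3) : Prop :=
  ContMDiff (𝓡 3) ((𝓡 3).prod (𝓡 3)) ∞ f ∧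
    ∀ p, Function.Injective (mfderiv (𝓡 3) ((𝓡 3).prod (𝓡 3)) f p)

/-- `f` is Lagrangian: `J TM = T^⊥M`, i.e. a vector tangent to `𝕊³ × 𝕊³` at `f p` is `J` applied to
a vector tangent to `M` if and only if it is `g`-orthogonal to all vectors tangent to `M`. -/
def IsLagrangian (f : M → S3 × S3) : Prop :=
  ∀ (p : M) (w : HH), IsTangent (toHH f p) w →
    ((∃ X : TangentSpace (𝓡 3) p, J (toHH f p) (mfderiv (𝓡 3) 𝓘(ℝ, HH) (toHH f) p X) = w) ↔
      ∀ Y : TangentSpace (𝓡 3) p,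
        g (toHH f p) w (mfderiv (𝓡 3) 𝓘(ℝ, HH) (toHH f) p Y) = 0)

/-- The local parametrization of the immersion `f` given by a chart `φ` of `M`. -/
def param (f : M → S3 × S3) (φ : OpenPartialHomeomorph M E3) : E3 → HH := toHH f ∘ φ.symm

/-- `f` is `J`-isotropic with function `lam`: `g((∇h)(v, v, v), J v) = λ g(v, v)²` for all tangent
vectors `v`. Both sides are tensorial; they are written in the charts of the atlas of `M`. -/
def IsJIsotropic (f : M → S3 × S3) (lam : M → ℝ) : Prop :=
  ∀ φ ∈ atlas E3 M, ∀ t ∈ φ.target, ∀ v : E3,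
    g (param f φ t) (nablaH (param f φ) t v v v) (J (param f φ t) (fderiv ℝ (param f φ) t v)) =
      lam (φ.symm t) *
        g (param f φ t) (fderiv ℝ (param f φ) t v) (fderiv ℝ (param f φ) t v) ^ 2

end Immersions

end NK

end

/-!
In the left-invariant frame of `𝕊³ × 𝕊³` the tensors `J`, `P`, `g`, `G` are constant, so that `∇̃`
and its curvature become linear algebra on pairs of imaginary quaternions. For a Lagrangian
immersion the form `C(X, Y, Z) = g(h(X, Y), JZ)` is symmetric and `G(TM, TM)` is normal.
Polarizing the `J`-isotropy condition and correcting for the failure of total symmetry of `∇C`,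
which the Codazzi equation expresses through `P`, `PJ` and `g(h, G)`, gives `12 ∇C` explicitly.
Differentiating this formula once more and antisymmetrizing, the second derivatives are controlled
by the Ricci identity for `C`; the Ricci equation then turns the result into the stated formula.
-/

noncomputable section

namespace NK

/-! ### The left-invariant tensors on pairs of imaginary quaternions -/

/-- A pair of imaginary quaternions, that is, a left-invariant vector field `x ↦ x * a` on
`𝕊³ × 𝕊³`. -/
def IsIm (a : HH) : Prop := a.1.re = 0 ∧ a.2.re = 0

/-- The left-invariant form of `J`: `J x (x * a) = x * invJ a`. -/
def invJ : HH →ₗ[ℝ] HH where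
  toFun a := (1 / √3 : ℝ) • ((2 : ℝ) • a.2 - a.1, a.2 - (2 : ℝ) • a.1)
  map_add' a b := by ext1 <;> simp <;> module
  map_smul' r a := by ext1 <;> simp <;> module

/-- The left-invariant form of `P`: `P x (x * a) = x * invP a`. -/
def invP : HH →ₗ[ℝ] HH where
  toFun a := (a.2, a.1)
  map_add' _ _ := rfl
  map_smul' _ _ := rfl

/-- The left-invariant form of the metric `g`. -/
def invg (a b : HH) : ℝ :=
  4 / 3 * (inner ℝ a.1 b.1 + inner ℝ a.2 b.2) - 2 / 3 * (inner ℝ a.1 b.2 + inner ℝ a.2 b.1)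

/-- The commutator of quaternions, twice the vector product on imaginary ones. -/
def quatComm : ℍ[ℝ] →ₗ[ℝ] ℍ[ℝ] →ₗ[ℝ] ℍ[ℝ] :=
  LinearMap.mul ℝ ℍ[ℝ] - (LinearMap.mul ℝ ℍ[ℝ]).flip

/-- The connection form of `∇̃` in the left-invariant frame: `connForm a b` is the covariant
derivative of the left-invariant field `b` in the direction `a`. -/
def connForm : HH →ₗ[ℝ] HH →ₗ[ℝ] HH :=
  LinearMap.mk₂ ℝ (fun a b =>
    ((1 / 2 : ℝ) • quatComm a.1 b.1 - (1 / 6 : ℝ) • (quatComm a.1 b.2 - quatComm a.2 b.1),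
     (1 / 2 : ℝ) • quatComm a.2 b.2 + (1 / 6 : ℝ) • (quatComm a.1 b.2 - quatComm a.2 b.1)))
    (fun a a' b => by ext1 <;> simp <;> module)
    (fun r a b => by ext1 <;> simp <;> module)
    (fun a b b' => by ext1 <;> simp <;> module)
    (fun r a b => by ext1 <;> simp <;> module)

/-- The left-invariant form of `G = ∇̃ J`. -/
def invG : HH →ₗ[ℝ] HH →ₗ[ℝ] HH := connForm.compl₂ invJ - connForm.compr₂ invJ

theorem invJ_apply (a : HH) :
    invJ a = (1 / √3 : ℝ) • ((2 : ℝ) • a.2 - a.1, a.2 - (2 : ℝ) • a.1) := rfl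

theorem invP_apply (a : HH) : invP a = (a.2, a.1) := rfl

theorem connForm_apply (a b : HH) : connForm a b =
    ((1 / 2 : ℝ) • quatComm a.1 b.1 - (1 / 6 : ℝ) • (quatComm a.1 b.2 - quatComm a.2 b.1),
     (1 / 2 : ℝ) • quatComm a.2 b.2 + (1 / 6 : ℝ) • (quatComm a.1 b.2 - quatComm a.2 b.1)) := rfl

theorem invG_apply (a b : HH) : invG a b = connForm a (invJ b) - invJ (connForm a b) := rfl

theorem one_div_sqrt_three_mul_self : (1 / √3 : ℝ) * (1 / √3) = 1 / 3 := by
  rw [div_mul_div_comm, Real.mul_self_sqrt (by norm_num), one_mul]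

theorem quatComm_apply (x y : ℍ[ℝ]) : quatComm x y = x * y - y * x := rfl

theorem quatComm_swap (x y : ℍ[ℝ]) : quatComm x y = -quatComm y x := (neg_sub _ _).symm

theorem connForm_sub_swap (a b : HH) : connForm a b - connForm b a = a * b - b * a := by
  ext1 <;> simp only [connForm_apply, quatComm_apply, Prod.fst_sub, Prod.snd_sub, Prod.fst_mul,
    Prod.snd_mul] <;> module

theorem re_quatComm (x y : ℍ[ℝ]) : (quatComm x y).re = 0 := by
  simp only [quatComm_apply, Quaternion.re_sub, Quaternion.re_mul]
  ring

theorem IsIm.add {a b : HH} (ha : IsIm a) (hb : IsIm b) : IsIm (a + b) := by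
  simp [IsIm, ha.1, ha.2, hb.1, hb.2]

theorem IsIm.sub {a b : HH} (ha : IsIm a) (hb : IsIm b) : IsIm (a - b) := by
  simp [IsIm, ha.1, ha.2, hb.1, hb.2]

theorem IsIm.invJ {a : HH} (ha : IsIm a) : IsIm (invJ a) := by
  simp [IsIm, invJ_apply, ha.1, ha.2]

theorem IsIm.invP {a : HH} (ha : IsIm a) : IsIm (invP a) := ⟨ha.2, ha.1⟩

theorem isIm_connForm (a b : HH) : IsIm (connForm a b) := by
  simp [IsIm, connForm_apply, re_quatComm]

theorem isIm_invG (a b : HH) : IsIm (invG a b) := by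
  rw [invG_apply]
  exact (isIm_connForm _ _).sub (isIm_connForm _ _).invJ

theorem invg_comm (a b : HH) : invg a b = invg b a := by
  simp only [invg, real_inner_comm]
  ring

theorem invg_smul_left (r : ℝ) (a b : HH) : invg (r • a) b = r * invg a b := by
  simp only [invg, Prod.smul_fst, Prod.smul_snd, real_inner_smul_left]
  ring

theorem invg_smul_right (r : ℝ) (a b : HH) : invg a (r • b) = r * invg a b := by
  rw [invg_comm, invg_smul_left, invg_comm]

theorem invJ_invJ (a : HH) : invJ (invJ a) = -a := by
  rw [invJ_apply a, map_smul, invJ_apply, smul_smul, one_div_sqrt_three_mul_self]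
  ext1 <;> simp <;> module

theorem invg_invJ_left (a b : HH) : invg (invJ a) b = -invg a (invJ b) := by
  rw [invJ_apply, invJ_apply, invg_smul_left, invg_smul_right]
  simp only [invg, inner_sub_left, real_inner_smul_left, inner_sub_right, real_inner_smul_right]
  ring

theorem invg_invP_left (a b : HH) : invg (invP a) b = invg a (invP b) := by
  simp only [invg, invP_apply]
  ring

theorem invP_invJ (a : HH) : invP (invJ a) = -invJ (invP a) := by
  ext1 <;> simp [invP_apply, invJ_apply] <;> module

theorem invg_pos_of_ne {a : HH} (ha : a ≠ 0) : 0 < invg a a := by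
  have sum_of_squares : invg a a = 2 / 3 * (‖a.1‖ ^ 2 + ‖a.2‖ ^ 2 + ‖a.1 - a.2‖ ^ 2) := by
    rw [norm_sub_sq_real, invg, real_inner_comm a.1 a.2, real_inner_self_eq_norm_sq,
      real_inner_self_eq_norm_sq]
    ring
  rw [sum_of_squares]
  rcases not_and_or.1 (mt Prod.ext_iff.2 ha) with h | h
  · have := norm_pos_iff.2 h
    positivity
  · have := norm_pos_iff.2 h
    positivity

theorem invG_apply_prod (a b : HH) : invG a b = (1 / (3 * √3) : ℝ) •
    (quatComm a.1 b.1 + quatComm a.1 b.2 + quatComm a.2 b.1 - (2 : ℝ) • quatComm a.2 b.2,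
      (2 : ℝ) • quatComm a.1 b.1 - quatComm a.1 b.2 - quatComm a.2 b.1 - quatComm a.2 b.2) := by
  simp only [invG_apply, connForm_apply, invJ_apply]
  ext1 <;> simp <;> module

theorem invG_antisymm (a b : HH) : invG a b = -invG b a := by
  simp only [invG_apply_prod, quatComm_swap b.1, quatComm_swap b.2]
  ext1 <;> simp <;> module

theorem invG_invJ (a b : HH) : invG a (invJ b) = -invJ (invG a b) := by
  simp only [invG_apply, invJ_invJ, map_sub, map_neg]
  abel

theorem inner_quatComm_left (x y z : ℍ[ℝ]) :
    inner ℝ (quatComm x y) z = -(inner ℝ y (quatComm x z) : ℝ) := by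
  simp only [inner_comp, quatComm_apply]
  simp
  ring

theorem invg_invG_left (a b c : HH) : invg (invG a b) c = -invg b (invG a c) := by
  rw [invG_apply_prod, invG_apply_prod, invg_smul_left, invg_smul_right]
  simp only [invg, inner_add_left, inner_sub_left, real_inner_smul_left, inner_quatComm_left,
    inner_sub_right, inner_add_right, real_inner_smul_right]
  ring

theorem quatComm_quatComm_of_im {x y z : ℍ[ℝ]} (hx : x.re = 0) (hy : y.re = 0) (hz : z.re = 0) :
    quatComm x (quatComm y z) = (4 * inner ℝ x z : ℝ) • y - (4 * inner ℝ x y : ℝ) • z := by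
  simp only [quatComm_apply, inner_comp]
  ext <;> simp [hx, hy, hz] <;> ring

theorem quatComm_quatComm_of_im' {x y z : ℍ[ℝ]} (hx : x.re = 0) (hy : y.re = 0) (hz : z.re = 0) :
    quatComm (quatComm x y) z = (4 * inner ℝ x z : ℝ) • y - (4 * inner ℝ y z : ℝ) • x := by
  rw [quatComm_swap, quatComm_quatComm_of_im hz hx hy, neg_sub, real_inner_comm x,
    real_inner_comm y]

theorem invG_covDeriv {a b c : HH} (ha : IsIm a) (hb : IsIm b) (hc : IsIm c) :
    connForm a (invG b c) - invG (connForm a b) c - invG b (connForm a c) =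
      (1 / 3 : ℝ) • (invg a c • invJ b - invg a b • invJ c - invg (invJ b) c • a) := by
  simp only [invG_apply_prod, map_smul, invJ_apply, connForm_apply, invg, map_add, map_sub,
    LinearMap.add_apply, LinearMap.sub_apply, LinearMap.smul_apply, quatComm_quatComm_of_im,
    quatComm_quatComm_of_im', ha.1, ha.2, hb.1, hb.2, hc.1, hc.2, inner_sub_left,
    real_inner_smul_left, Prod.mk_sub_mk, Prod.smul_mk]
  simp only [real_inner_comm a.1 b.1, real_inner_comm a.1 b.2, real_inner_comm a.2 b.1,
    real_inner_comm a.2 b.2]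
  ext1 <;> simp only [Prod.fst_sub, Prod.snd_sub, Prod.smul_fst, Prod.smul_snd] <;> module

theorem invg_invJ_smul_invJ (a b c : HH) : invg (invJ a) b • invJ c =
    (1 / 3 * invg ((2 : ℝ) • a.2 - a.1, a.2 - (2 : ℝ) • a.1) b) •
      ((2 : ℝ) • c.2 - c.1, c.2 - (2 : ℝ) • c.1) := by
  rw [invJ_apply, invJ_apply, invg_smul_left, smul_smul, mul_right_comm,
    one_div_sqrt_three_mul_self]

theorem connForm_curvature {a b c : HH} (ha : IsIm a) (hb : IsIm b) (hc : IsIm c) :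
    connForm a (connForm b c) - connForm b (connForm a c) - connForm (a * b - b * a) c =
      (5 / 12 : ℝ) • (invg b c • a - invg a c • b)
      + (1 / 12 : ℝ) • (invg (invJ b) c • invJ a - invg (invJ a) c • invJ b
          - (2 * invg (invJ a) b) • invJ c)
      + (1 / 3 : ℝ) • (invg (invP b) c • invP a - invg (invP a) c • invP b
          + invg (invJ (invP b)) c • invJ (invP a) - invg (invJ (invP a)) c • invJ (invP b)) := by
  have bracket : a * b - b * a = (quatComm a.1 b.1, quatComm a.2 b.2) := rfl
  rw [bracket]
  simp only [mul_smul, invg_invJ_smul_invJ]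
  simp only [connForm_apply, invg, invP_apply, map_add, map_sub,
    map_smul, quatComm_quatComm_of_im, quatComm_quatComm_of_im', ha.1, ha.2, hb.1, hb.2, hc.1, hc.2,
    inner_sub_left, real_inner_smul_left, Prod.mk_sub_mk, Prod.smul_mk, Prod.mk_add_mk]
  simp only [real_inner_comm a.1 b.1, real_inner_comm a.1 b.2, real_inner_comm a.2 b.1,
    real_inner_comm a.2 b.2]
  ext1 <;> simp only [Prod.fst_add, Prod.snd_add, Prod.fst_sub, Prod.snd_sub, Prod.smul_fst,
    Prod.smul_snd] <;> module

/-! ### Tangent vectors of `𝕊³ × 𝕊³` in the left-invariant frame -/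

theorem OnS.star_mul_mul {x : HH} (hx : OnS x) (a : HH) : star x * (x * a) = a :=
  Prod.ext (NK.star_mul_mul hx.1 _) (NK.star_mul_mul hx.2 _)

theorem OnS.mul_star_mul {x : HH} (hx : OnS x) (w : HH) : x * (star x * w) = w := by
  ext1 <;> simp [← mul_assoc, self_mul_star_of hx.1, self_mul_star_of hx.2]

theorem OnS.fst_ne_zero {x : HH} (hx : OnS x) : x.1 ≠ 0 := norm_ne_zero_iff.1 (by simp [hx.1])

theorem OnS.snd_ne_zero {x : HH} (hx : OnS x) : x.2 ≠ 0 := norm_ne_zero_iff.1 (by simp [hx.2])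

theorem isTangent_mul_iff {x : HH} (hx : OnS x) (a : HH) : IsTangent x (x * a) ↔ IsIm a := by
  have inner_fst := inner_mul_left_of hx.1 1 a.1
  have inner_snd := inner_mul_left_of hx.2 1 a.2
  rw [mul_one] at inner_fst inner_snd
  simp [IsTangent, IsIm, inner_fst, inner_snd, inner_comp]

theorem IsTangent.isIm_star_mul {x w : HH} (hx : OnS x) (hw : IsTangent x w) :
    IsIm (star x * w) := by
  rwa [← isTangent_mul_iff hx, hx.mul_star_mul]

theorem IsTangent.exists_eq_mul {x w : HH} (hx : OnS x) (hw : IsTangent x w) :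
    ∃ a, IsIm a ∧ w = x * a :=
  ⟨star x * w, hw.isIm_star_mul hx, (hx.mul_star_mul w).symm⟩

theorem J_mul {x : HH} (h₁ : x.1 ≠ 0) (h₂ : x.2 ≠ 0) (a : HH) : J x (x * a) = x * invJ a := by
  ext1 <;> simp [J, invJ_apply, mul_assoc, h₁, h₂, mul_sub]
  module

theorem P_mul {x : HH} (h₁ : x.1 ≠ 0) (h₂ : x.2 ≠ 0) (a : HH) : P x (x * a) = x * invP a := by
  ext1 <;> simp [P, invP_apply, mul_assoc, h₁, h₂]

theorem PJ_mul {x : HH} (h₁ : x.1 ≠ 0) (h₂ : x.2 ≠ 0) (a : HH) :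
    PJ x (x * a) = x * (invP ∘ₗ invJ) a := by
  rw [PJ, J_mul h₁ h₂, P_mul h₁ h₂, LinearMap.comp_apply]

theorem g_mul {x : HH} (hx : OnS x) (a b : HH) : g x (x * a) (x * b) = invg a b := by
  simp only [g_eq hx, prodInner, invg, Prod.fst_mul, Prod.snd_mul, star_mul_mul hx.1,
    star_mul_mul hx.2, inner_mul_left_of hx.1, inner_mul_left_of hx.2, real_inner_comm b.1]

theorem J_add (x w w' : HH) : J x (w + w') = J x w + J x w' := by
  ext1 <;> simp only [J, Prod.fst_add, Prod.snd_add, mul_add] <;> module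

theorem J_smul (x : HH) (r : ℝ) (w : HH) : J x (r • w) = r • J x w := by
  ext1 <;> simp only [J, Prod.smul_fst, Prod.smul_snd, mul_smul_comm] <;> module

theorem J_sub (x w w' : HH) : J x (w - w') = J x w - J x w' := by
  ext1 <;> simp only [J, Prod.fst_sub, Prod.snd_sub, mul_sub] <;> module

theorem J_zero (x : HH) : J x 0 = 0 := by
  simpa only [zero_smul] using J_smul x 0 0

theorem P_add (x w w' : HH) : P x (w + w') = P x w + P x w' := by
  ext1 <;> simp [P, mul_add]

theorem PJ_add (x w w' : HH) : PJ x (w + w') = PJ x w + PJ x w' := by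
  simp only [PJ, J_add, P_add]

theorem g_comm (x w w' : HH) : g x w w' = g x w' w := by
  simp only [g, prodInner, real_inner_comm]

/-- The metric `g` at `x` as a bilinear form on `ℍ × ℍ`. -/
def gForm (x : HH) : LinearMap.BilinForm ℝ HH :=
  LinearMap.mk₂ ℝ (g x)
    (fun w w' v => by
      simp only [g, prodInner, J_add, Prod.fst_add, Prod.snd_add, inner_add_left]
      ring)
    (fun r w v => by
      simp only [g, prodInner, J_smul, Prod.smul_fst, Prod.smul_snd, real_inner_smul_left,
        smul_eq_mul]
      ring)
    (fun w v v' => by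
      simp only [g, prodInner, J_add, Prod.fst_add, Prod.snd_add, inner_add_right]
      ring)
    (fun r w v => by
      simp only [g, prodInner, J_smul, Prod.smul_fst, Prod.smul_snd, real_inner_smul_right,
        smul_eq_mul]
      ring)

theorem g_add_left (x w w' v : HH) : g x (w + w') v = g x w v + g x w' v :=
  (gForm x).map_add₂ w w' v

theorem g_sub_left (x w w' v : HH) : g x (w - w') v = g x w v - g x w' v :=
  (gForm x).map_sub₂ w w' v

theorem g_neg_left (x w v : HH) : g x (-w) v = -g x w v := (gForm x).map_neg₂ w v

theorem g_smul_left (x : HH) (r : ℝ) (w v : HH) : g x (r • w) v = r * g x w v :=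
  (gForm x).map_smul₂ r w v

theorem g_add_right (x v w w' : HH) : g x v (w + w') = g x v w + g x v w' :=
  (gForm x v).map_add w w'

theorem g_sub_right (x v w w' : HH) : g x v (w - w') = g x v w - g x v w' :=
  (gForm x v).map_sub w w'

theorem g_neg_right (x v w : HH) : g x v (-w) = -g x v w := (gForm x v).map_neg w

theorem g_smul_right (x : HH) (r : ℝ) (v w : HH) : g x v (r • w) = r * g x v w :=
  (gForm x v).map_smul r w

theorem g_zero_right (x v : HH) : g x v 0 = 0 := (gForm x v).map_zero

theorem g_sum_left {ι : Type*} (s : Finset ι) (x : HH) (w : ι → HH) (v : HH) :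
    g x (∑ i ∈ s, w i) v = ∑ i ∈ s, g x (w i) v :=
  map_sum ((gForm x).flip v) w s

theorem g_self_pos {x w : HH} (hx : OnS x) (hw : w ≠ 0) : 0 < g x w w := by
  rw [← hx.mul_star_mul w, g_mul hx]
  refine invg_pos_of_ne fun h => hw ?_
  rw [← hx.mul_star_mul w, h, mul_zero]

theorem J_J {x : HH} (hx : OnS x) (w : HH) : J x (J x w) = -w := by
  rw [← hx.mul_star_mul w]
  simp only [J_mul hx.fst_ne_zero hx.snd_ne_zero, invJ_invJ, mul_neg]

theorem g_J_left {x : HH} (hx : OnS x) (w v : HH) : g x (J x w) v = -g x w (J x v) := by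
  rw [← hx.mul_star_mul w, ← hx.mul_star_mul v]
  simp only [J_mul hx.fst_ne_zero hx.snd_ne_zero, g_mul hx, invg_invJ_left]

theorem g_J_J {x : HH} (hx : OnS x) (w v : HH) : g x (J x w) (J x v) = g x w v := by
  rw [g_J_left hx, J_J hx, g_neg_right, neg_neg]

theorem g_P_left {x : HH} (hx : OnS x) (w v : HH) : g x (P x w) v = g x w (P x v) := by
  rw [← hx.mul_star_mul w, ← hx.mul_star_mul v]
  simp only [P_mul hx.fst_ne_zero hx.snd_ne_zero, g_mul hx, invg_invP_left]

theorem PJ_eq {x : HH} (hx : OnS x) (w : HH) : PJ x w = -J x (P x w) := by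
  rw [PJ, ← hx.mul_star_mul w]
  simp only [J_mul hx.fst_ne_zero hx.snd_ne_zero, P_mul hx.fst_ne_zero hx.snd_ne_zero, invP_invJ,
    mul_neg]

theorem J_P {x : HH} (hx : OnS x) (w : HH) : J x (P x w) = -PJ x w := by rw [PJ_eq hx, neg_neg]

theorem g_PJ_left {x : HH} (hx : OnS x) (w v : HH) : g x (PJ x w) v = g x w (PJ x v) := by
  rw [PJ, g_P_left hx, g_J_left hx, J_P hx, g_neg_right, neg_neg]

theorem g_P_J {x : HH} (hx : OnS x) (w v : HH) : g x (P x w) (J x v) = g x (PJ x w) v := by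
  rw [g_P_left hx, g_PJ_left hx, PJ]

theorem g_PJ_J {x : HH} (hx : OnS x) (w v : HH) : g x (PJ x w) (J x v) = -g x (P x w) v := by
  rw [PJ_eq hx, g_neg_left, g_J_J hx]

theorem isTangent_J {x w : HH} (hx : OnS x) (hw : IsTangent x w) : IsTangent x (J x w) := by
  obtain ⟨a, ha, rfl⟩ := hw.exists_eq_mul hx
  rw [J_mul hx.fst_ne_zero hx.snd_ne_zero, isTangent_mul_iff hx]
  exact ha.invJ

theorem IsTangent.add {x w w' : HH} (hw : IsTangent x w) (hw' : IsTangent x w') :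
    IsTangent x (w + w') := by
  simp [IsTangent, inner_add_right, hw.1, hw.2, hw'.1, hw'.2]

theorem IsTangent.neg {x w : HH} (hw : IsTangent x w) : IsTangent x (-w) := by
  simp [IsTangent, hw.1, hw.2]

theorem IsTangent.sub {x w w' : HH} (hw : IsTangent x w) (hw' : IsTangent x w') :
    IsTangent x (w - w') := sub_eq_add_neg w w' ▸ hw.add hw'.neg

/-! ### The connection in the left-invariant frame -/

section Frame

/-- The field `T` of endomorphisms of the tangent bundle of `𝕊³ × 𝕊³` is left-invariant, and `τ` is
its expression in the left-invariant frame. The first condition is imposed near `𝕊³ × 𝕊³` because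
`covDeriv` differentiates `T` in `ℍ × ℍ`. -/
structure HasFrameForm (T : HH → HH → HH) (τ : HH →ₗ[ℝ] HH) : Prop where
  apply_mul : ∀ {y : HH}, y.1 ≠ 0 → y.2 ≠ 0 → ∀ a, T y (y * a) = y * τ a
  isIm : ∀ {a : HH}, IsIm a → IsIm (τ a)

theorem hasFrameForm_J : HasFrameForm J invJ := ⟨J_mul, IsIm.invJ⟩

theorem hasFrameForm_P : HasFrameForm P invP := ⟨P_mul, IsIm.invP⟩

theorem hasFrameForm_PJ : HasFrameForm PJ (invP ∘ₗ invJ) := ⟨PJ_mul, fun ha => ha.invJ.invP⟩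

theorem nabla_eq_mul {E : Type*} [NormedAddCommGroup E] [NormedSpace ℝ E] {u ξ : E → HH} {t X : E}
    {a b c : HH} (hu : OnS (u t)) (ha : IsIm a) (hb : IsIm b) (hc : IsIm c)
    (hua : fderiv ℝ u t X = u t * a) (hξ : ξ t = u t * b)
    (hξ' : fderiv ℝ ξ t X = u t * (a * b + c)) :
    nabla u ξ t X = u t * (c + connForm a b) := by
  have im_part : ∀ {a b c : ℍ[ℝ]}, a.re = 0 → b.re = 0 → c.re = 0 →
      a * b + c - (((a * b + c).re : ℝ) : ℍ[ℝ]) = c + (1 / 2 : ℝ) • quatComm a b := by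
    intro a b c ha hb hc
    ext <;> simp [quatComm_apply, ha, hb, hc] <;> ring
  rw [nabla, hua, hξ, hξ']
  generalize u t = x at hu
  obtain ⟨p, q⟩ := x
  obtain ⟨hp, hq⟩ := hu
  obtain ⟨a₁, a₂⟩ := a
  obtain ⟨b₁, b₂⟩ := b
  obtain ⟨c₁, c₂⟩ := c
  simp only [Prod.mk_mul_mk, Prod.mk_add_mk]
  rw [tanProj_mul hp hq, diffTensor_mul hp hq, im_part ha.1 hb.1 hc.1, im_part ha.2 hb.2 hc.2,
    Prod.mk_add_mk, ← mul_add, ← mul_add, connForm_apply]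
  ext1 <;> simp only [Prod.mk_mul_mk, Prod.mk_add_mk, quatComm_apply] <;> congr 1 <;> module

theorem leftExt_mul {x : HH} (hx : OnS x) (b y : HH) : leftExt x (x * b) y = y * b := by
  ext1 <;> simp [leftExt, mul_assoc, hx.fst_ne_zero, hx.snd_ne_zero]

theorem nabla_id_mul {x : HH} (hx : OnS x) {a c : HH} (ha : IsIm a) (hc : IsIm c)
    {ξ : HH → HH} (hξ : ∀ᶠ y in nhds x, ξ y = y * c) :
    nabla (fun y => y) ξ x (x * a) = x * connForm a c := by
  have fderiv_ξ : fderiv ℝ ξ x (x * a) = x * (a * c + 0) := by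
    rw [Filter.EventuallyEq.fderiv_eq (f₁ := ξ) (f := fun y => y * c) hξ,
      fderiv_mul_const' differentiableAt_id]
    simp [mul_assoc]
  simpa only [zero_add] using nabla_eq_mul (u := fun y : HH => y) (c := 0) hx ha hc ⟨rfl, rfl⟩
    (by simp) hξ.self_of_nhds fderiv_ξ

theorem HasFrameForm.covDeriv_mul {T : HH → HH → HH} {τ : HH →ₗ[ℝ] HH} (hT : HasFrameForm T τ)
    {x : HH} (hx : OnS x) {a b : HH} (ha : IsIm a) (hb : IsIm b) :
    covDeriv T x (x * a) (x * b) = x * (connForm a (τ b) - τ (connForm a b)) := by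
  have ne_zero : ∀ᶠ y : HH in nhds x, y.1 ≠ 0 ∧ y.2 ≠ 0 :=
    (continuous_fst.continuousAt.eventually_ne hx.fst_ne_zero).and
      (continuous_snd.continuousAt.eventually_ne hx.snd_ne_zero)
  rw [covDeriv, nabla_id_mul hx ha hb (.of_forall fun y => leftExt_mul hx b y),
    nabla_id_mul hx ha (hT.isIm hb)
      (ne_zero.mono fun y hy => by rw [leftExt_mul hx, hT.apply_mul hy.1 hy.2]),
    hT.apply_mul hx.fst_ne_zero hx.snd_ne_zero, mul_sub]

theorem G_mul {x : HH} (hx : OnS x) {a b : HH} (ha : IsIm a) (hb : IsIm b) :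
    G x (x * a) (x * b) = x * invG a b :=
  hasFrameForm_J.covDeriv_mul hx ha hb

theorem isTangent_G {x w v : HH} (hx : OnS x) (hw : IsTangent x w) (hv : IsTangent x v) :
    IsTangent x (G x w v) := by
  obtain ⟨a, ha, rfl⟩ := hw.exists_eq_mul hx
  obtain ⟨b, hb, rfl⟩ := hv.exists_eq_mul hx
  rw [G_mul hx ha hb, isTangent_mul_iff hx]
  exact isIm_invG a b

theorem G_antisymm {x w v : HH} (hx : OnS x) (hw : IsTangent x w) (hv : IsTangent x v) :
    G x w v = -G x v w := by
  obtain ⟨a, ha, rfl⟩ := hw.exists_eq_mul hx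
  obtain ⟨b, hb, rfl⟩ := hv.exists_eq_mul hx
  rw [G_mul hx ha hb, G_mul hx hb ha, invG_antisymm, mul_neg]

theorem G_add_right {x w v v' : HH} (hx : OnS x) (hw : IsTangent x w) (hv : IsTangent x v)
    (hv' : IsTangent x v') : G x w (v + v') = G x w v + G x w v' := by
  obtain ⟨a, ha, rfl⟩ := hw.exists_eq_mul hx
  obtain ⟨b, hb, rfl⟩ := hv.exists_eq_mul hx
  obtain ⟨c, hc, rfl⟩ := hv'.exists_eq_mul hx
  rw [← mul_add, G_mul hx ha hb, G_mul hx ha hc, G_mul hx ha (hb.add hc), map_add, mul_add]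

theorem G_add_left {x w w' v : HH} (hx : OnS x) (hw : IsTangent x w) (hw' : IsTangent x w')
    (hv : IsTangent x v) : G x (w + w') v = G x w v + G x w' v := by
  rw [G_antisymm hx (hw.add hw') hv, G_add_right hx hv hw hw', G_antisymm hx hw hv,
    G_antisymm hx hw' hv, neg_add]

theorem g_G_left {x w v z : HH} (hx : OnS x) (hw : IsTangent x w) (hv : IsTangent x v)
    (hz : IsTangent x z) : g x (G x w v) z = -g x v (G x w z) := by
  obtain ⟨a, ha, rfl⟩ := hw.exists_eq_mul hx
  obtain ⟨b, hb, rfl⟩ := hv.exists_eq_mul hx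
  obtain ⟨c, hc, rfl⟩ := hz.exists_eq_mul hx
  rw [G_mul hx ha hb, G_mul hx ha hc, g_mul hx, g_mul hx, invg_invG_left]

theorem G_J {x w v : HH} (hx : OnS x) (hw : IsTangent x w) (hv : IsTangent x v) :
    G x w (J x v) = -J x (G x w v) := by
  obtain ⟨a, ha, rfl⟩ := hw.exists_eq_mul hx
  obtain ⟨b, hb, rfl⟩ := hv.exists_eq_mul hx
  simp only [J_mul hx.fst_ne_zero hx.snd_ne_zero, G_mul hx ha hb, G_mul hx ha hb.invJ, invG_invJ,
    mul_neg]

/-- The curvature tensor of `∇̃`. -/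
def curvS (x X Y Z : HH) : HH :=
  (5 / 12 : ℝ) • (g x Y Z • X - g x X Z • Y)
  + (1 / 12 : ℝ) • (g x (J x Y) Z • J x X - g x (J x X) Z • J x Y - (2 * g x (J x X) Y) • J x Z)
  + (1 / 3 : ℝ) • (g x (P x Y) Z • P x X - g x (P x X) Z • P x Y
      + g x (J x (P x Y)) Z • J x (P x X) - g x (J x (P x X)) Z • J x (P x Y))

theorem curvS_mul {x : HH} (hx : OnS x) {a b c : HH} (ha : IsIm a) (hb : IsIm b) (hc : IsIm c) :
    curvS x (x * a) (x * b) (x * c) =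
      x * (connForm a (connForm b c) - connForm b (connForm a c) - connForm (a * b - b * a) c) := by
  rw [connForm_curvature ha hb hc]
  simp only [curvS, P_mul hx.fst_ne_zero hx.snd_ne_zero, J_mul hx.fst_ne_zero hx.snd_ne_zero,
    g_mul hx, mul_add, mul_sub, mul_smul_comm]

end Frame

/-! ### Calculus on open sets -/

section Calculus

variable {E F F' F'' : Type*} [NormedAddCommGroup E] [NormedSpace ℝ E] [NormedAddCommGroup F]
  [NormedSpace ℝ F] [NormedAddCommGroup F'] [NormedSpace ℝ F'] [NormedAddCommGroup F'']
  [NormedSpace ℝ F''] {O : Set E} {f : E → F} {f' : E → F'} {t : E}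

theorem differentiableAt_of_contDiffOn (hO : IsOpen O) (hf : ContDiffOn ℝ ∞ f O) (ht : t ∈ O) :
    DifferentiableAt ℝ f t :=
  (hf.contDiffAt (hO.mem_nhds ht)).differentiableAt (by simp)

theorem hasFDerivAt_of_contDiffOn (hO : IsOpen O) (hf : ContDiffOn ℝ ∞ f O) (ht : t ∈ O) :
    HasFDerivAt f (fderiv ℝ f t) t :=
  (differentiableAt_of_contDiffOn hO hf ht).hasFDerivAt

theorem fderiv_congr_of_eqOn {f₁ f₂ : E → F} (hO : IsOpen O) (hf : Set.EqOn f₁ f₂ O)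
    (ht : t ∈ O) : fderiv ℝ f₁ t = fderiv ℝ f₂ t :=
  (hf.eventuallyEq_of_mem (hO.mem_nhds ht)).fderiv_eq

theorem fderiv_apply_eq_zero_of_const_on {c : F} (hO : IsOpen O) (hf : ∀ s ∈ O, f s = c)
    (ht : t ∈ O) (X : E) : fderiv ℝ f t X = 0 := by
  rw [fderiv_congr_of_eqOn (f₂ := fun _ => c) hO hf ht, fderiv_fun_const, Pi.zero_apply,
    _root_.zero_apply]

theorem contDiffOn_fderiv_apply (hO : IsOpen O) (hf : ContDiffOn ℝ ∞ f O) {X : E → E}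
    (hX : ContDiffOn ℝ ∞ X O) : ContDiffOn ℝ ∞ (fun s => fderiv ℝ f s (X s)) O :=
  ((contDiffOn_infty_iff_fderiv_of_isOpen hO).1 hf).2.clm_apply hX

theorem fderiv_fderiv_comm (hO : IsOpen O) (hf : ContDiffOn ℝ ∞ f O) (ht : t ∈ O) (X Y : E) :
    fderiv ℝ (fun s => fderiv ℝ f s Y) t X = fderiv ℝ (fun s => fderiv ℝ f s X) t Y := by
  have hc := hf.contDiffAt (hO.mem_nhds ht)
  have hd : DifferentiableAt ℝ (fderiv ℝ f) t :=
    (hc.fderiv_right (m := 1) (by norm_cast)).differentiableAt (by norm_num)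
  rw [fderiv_clm_apply hd (differentiableAt_const _), fderiv_clm_apply hd
    (differentiableAt_const _)]
  simpa using (hc.isSymmSndFDerivAt (by simp; norm_cast)) X Y

theorem contDiffOn_linearMap_apply [FiniteDimensional ℝ F] (B : F →ₗ[ℝ] F') {n : WithTop ℕ∞}
    (hf : ContDiffOn ℝ n f O) : ContDiffOn ℝ n (fun s => B (f s)) O :=
  (LinearMap.toContinuousLinearMap B).contDiff.comp_contDiffOn hf

theorem fderiv_linearMap_apply [FiniteDimensional ℝ F] (B : F →ₗ[ℝ] F')
    (hf : DifferentiableAt ℝ f t) (X : E) :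
    fderiv ℝ (fun s => B (f s)) t X = B (fderiv ℝ f t X) :=
  DFunLike.congr_fun
    ((LinearMap.toContinuousLinearMap B).hasFDerivAt.comp t hf.hasFDerivAt).fderiv X

variable [FiniteDimensional ℝ F] [FiniteDimensional ℝ F'] (B : F →ₗ[ℝ] F' →ₗ[ℝ] F'')

theorem contDiffOn_bilinearMap_apply {n : WithTop ℕ∞} (hf : ContDiffOn ℝ n f O)
    (hf' : ContDiffOn ℝ n f' O) : ContDiffOn ℝ n (fun s => B (f s) (f' s)) O :=
  (B.toContinuousBilinearMap.contDiff.comp_contDiffOn hf).clm_apply hf'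

theorem fderiv_bilinearMap_apply (hf : DifferentiableAt ℝ f t) (hf' : DifferentiableAt ℝ f' t)
    (X : E) : fderiv ℝ (fun s => B (f s) (f' s)) t X =
      B (fderiv ℝ f t X) (f' t) + B (f t) (fderiv ℝ f' t X) := by
  have h := DFunLike.congr_fun
    ((B.toContinuousBilinearMap.hasFDerivAt.comp t hf.hasFDerivAt).clm_apply
      hf'.hasFDerivAt).fderiv X
  simp only [Function.comp_def, LinearMap.toContinuousBilinearMap_apply] at h
  rw [h]
  simp [add_comm]

end Calculus

/-! ### Vector fields along maps to `𝕊³ × 𝕊³` -/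

section Maps

variable {E : Type*} [NormedAddCommGroup E] [NormedSpace ℝ E]

/-- `u` is a smooth map to `𝕊³ × 𝕊³` on the open set `O`. -/
structure IsMapOn (u : E → HH) (O : Set E) : Prop where
  isOpen : IsOpen O
  smooth : ContDiffOn ℝ ∞ u O
  onS : ∀ s ∈ O, OnS (u s)

/-- `ξ` is a smooth field of tangent vectors of `𝕊³ × 𝕊³` along `u` on `O`. -/
structure IsFieldOn (u : E → HH) (O : Set E) (ξ : E → HH) : Prop where
  smooth : ContDiffOn ℝ ∞ ξ O
  tangent : ∀ s ∈ O, IsTangent (u s) (ξ s)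

/-- The coordinates of a vector field along `u` in the left-invariant frame. -/
def triv (u ξ : E → HH) (s : E) : HH := star (u s) * ξ s

theorem contDiffOn_triv {u ξ : E → HH} {O : Set E} (hu : ContDiffOn ℝ ∞ u O)
    (hξ : ContDiffOn ℝ ∞ ξ O) : ContDiffOn ℝ ∞ (triv u ξ) O := by
  let conj : HH →ₗ[ℝ] HH :=
    { toFun := star, map_add' := star_add, map_smul' := fun r x => by ext <;> simp }
  exact (contDiffOn_linearMap_apply conj hu).mul hξ

namespace IsMapOn

variable {u ξ η : E → HH} {O : Set E} {t : E}

theorem differentiableAt (hu : IsMapOn u O) (ht : t ∈ O) : DifferentiableAt ℝ u t :=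
  differentiableAt_of_contDiffOn hu.isOpen hu.smooth ht

theorem eventually_mem (hu : IsMapOn u O) (ht : t ∈ O) : ∀ᶠ s in nhds t, s ∈ O :=
  hu.isOpen.mem_nhds ht

theorem isField_fderiv (hu : IsMapOn u O) {X : E → E} (hX : ContDiffOn ℝ ∞ X O) :
    IsFieldOn u O (fun s => fderiv ℝ u s (X s)) :=
  ⟨contDiffOn_fderiv_apply hu.isOpen hu.smooth hX, fun _ hs =>
    fderiv_onS (hu.differentiableAt hs) ((hu.eventually_mem hs).mono hu.onS) _⟩

theorem isField_fderiv_const (hu : IsMapOn u O) (X : E) :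
    IsFieldOn u O (fun s => fderiv ℝ u s X) := hu.isField_fderiv contDiffOn_const

theorem isTangent_fderiv (hu : IsMapOn u O) (ht : t ∈ O) (X : E) :
    IsTangent (u t) (fderiv ℝ u t X) := (hu.isField_fderiv_const X).tangent t ht

theorem nabla_fderiv_comm (hu : IsMapOn u O) (ht : t ∈ O) (X Y : E) :
    nabla u (fun s => fderiv ℝ u s Y) t X = nabla u (fun s => fderiv ℝ u s X) t Y :=
  nabla_torsionFree ((hu.smooth.contDiffAt (hu.isOpen.mem_nhds ht)).of_le (by norm_cast)) X Y

theorem mul_triv (hu : IsMapOn u O) (ht : t ∈ O) (ξ : E → HH) : u t * triv u ξ t = ξ t :=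
  (hu.onS t ht).mul_star_mul _

theorem differentiableAt_triv (hu : IsMapOn u O) (hξ : IsFieldOn u O ξ) (ht : t ∈ O) :
    DifferentiableAt ℝ (triv u ξ) t :=
  differentiableAt_of_contDiffOn hu.isOpen (contDiffOn_triv hu.smooth hξ.smooth) ht

theorem isIm_triv (hu : IsMapOn u O) (hξ : IsFieldOn u O ξ) (ht : t ∈ O) : IsIm (triv u ξ t) :=
  (hξ.tangent t ht).isIm_star_mul (hu.onS t ht)

theorem isIm_fderiv_triv (hu : IsMapOn u O) (hξ : IsFieldOn u O ξ) (ht : t ∈ O) (X : E) :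
    IsIm (fderiv ℝ (triv u ξ) t X) := by
  have hd := hu.differentiableAt_triv hξ ht
  have apply_eq_zero (r : HH →ₗ[ℝ] ℝ) (hr : ∀ s ∈ O, r (triv u ξ s) = 0) :
      r (fderiv ℝ (triv u ξ) t X) = 0 := by
    rw [← fderiv_linearMap_apply r hd, fderiv_apply_eq_zero_of_const_on hu.isOpen hr ht]
  let re : ℍ[ℝ] →ₗ[ℝ] ℝ :=
    { toFun := fun a => a.re, map_add' := fun _ _ => rfl, map_smul' := fun _ _ => rfl }
  exact ⟨apply_eq_zero (re ∘ₗ LinearMap.fst ℝ _ _) fun s hs => (hu.isIm_triv hξ hs).1,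
    apply_eq_zero (re ∘ₗ LinearMap.snd ℝ _ _) fun s hs => (hu.isIm_triv hξ hs).2⟩

theorem nabla_eq (hu : IsMapOn u O) (hξ : IsFieldOn u O ξ) (ht : t ∈ O) (X : E) :
    nabla u ξ t X = u t * (fderiv ℝ (triv u ξ) t X +
      connForm (triv u (fun s => fderiv ℝ u s X) t) (triv u ξ t)) := by
  have eq_mul_triv : ξ =ᶠ[nhds t] fun s => u s * triv u ξ s :=
    (hu.eventually_mem ht).mono fun s hs => (hu.mul_triv hs ξ).symm
  have hX := hu.mul_triv ht (fun s => fderiv ℝ u s X)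
  refine nabla_eq_mul (hu.onS t ht) (hu.isIm_triv (hu.isField_fderiv_const X) ht)
    (hu.isIm_triv hξ ht) (hu.isIm_fderiv_triv hξ ht X) hX.symm (hu.mul_triv ht ξ).symm ?_
  rw [eq_mul_triv.fderiv_eq,
    fderiv_fun_mul' (hu.differentiableAt ht) (hu.differentiableAt_triv hξ ht)]
  simp only [_root_.add_apply, _root_.smul_apply, MulOpposite.smul_eq_mul_unop,
    MulOpposite.unop_op, smul_eq_mul]
  rw [mul_add, ← mul_assoc, hX, add_comm]

theorem triv_eq (hu : IsMapOn u O) (ht : t ∈ O) {a : HH} (hξ : ξ t = u t * a) :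
    triv u ξ t = a := by
  rw [triv, hξ, (hu.onS t ht).star_mul_mul]

theorem fderiv_triv_eq (hu : IsMapOn u O) (ht : t ∈ O) {α : E → HH}
    (hξ : ∀ s ∈ O, ξ s = u s * α s) : fderiv ℝ (triv u ξ) t = fderiv ℝ α t :=
  fderiv_congr_of_eqOn hu.isOpen (fun s hs => hu.triv_eq hs (hξ s hs)) ht

theorem triv_nabla (hu : IsMapOn u O) (hξ : IsFieldOn u O ξ) (ht : t ∈ O) (X : E) :
    triv u (fun s => nabla u ξ s X) t = fderiv ℝ (triv u ξ) t X +
      connForm (triv u (fun s => fderiv ℝ u s X) t) (triv u ξ t) :=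
  hu.triv_eq (ξ := fun s => nabla u ξ s X) ht (hu.nabla_eq hξ ht X)

theorem isField_of_eq_mul (hu : IsMapOn u O) {α : E → HH} (hα : ContDiffOn ℝ ∞ α O)
    (him : ∀ s ∈ O, IsIm (α s)) (hξ : ∀ s ∈ O, ξ s = u s * α s) : IsFieldOn u O ξ :=
  ⟨(hu.smooth.mul hα).congr hξ, fun s hs => by
    rw [hξ s hs, isTangent_mul_iff (hu.onS s hs)]
    exact him s hs⟩

theorem isField_nabla (hu : IsMapOn u O) (hξ : IsFieldOn u O ξ) (X : E) :
    IsFieldOn u O (fun s => nabla u ξ s X) := by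
  have hα := contDiffOn_triv hu.smooth hξ.smooth
  have hX := contDiffOn_triv hu.smooth (hu.isField_fderiv_const X).smooth
  exact hu.isField_of_eq_mul
    ((contDiffOn_fderiv_apply hu.isOpen hα contDiffOn_const).add
      (contDiffOn_bilinearMap_apply connForm hX hα))
    (fun s hs => (hu.isIm_fderiv_triv hξ hs X).add (isIm_connForm _ _))
    fun s hs => hu.nabla_eq hξ hs X

theorem apply_eq_mul (hu : IsMapOn u O) {T : HH → HH → HH} {τ : HH →ₗ[ℝ] HH}
    (hT : HasFrameForm T τ) (ht : t ∈ O) (ξ : E → HH) : T (u t) (ξ t) = u t * τ (triv u ξ t) := by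
  rw [← hT.apply_mul (hu.onS t ht).fst_ne_zero (hu.onS t ht).snd_ne_zero, hu.mul_triv ht]

theorem isField_apply (hu : IsMapOn u O) (hξ : IsFieldOn u O ξ) {T : HH → HH → HH}
    {τ : HH →ₗ[ℝ] HH} (hT : HasFrameForm T τ) : IsFieldOn u O (fun s => T (u s) (ξ s)) :=
  hu.isField_of_eq_mul (contDiffOn_linearMap_apply τ (contDiffOn_triv hu.smooth hξ.smooth))
    (fun _ hs => hT.isIm (hu.isIm_triv hξ hs)) (fun _ hs => hu.apply_eq_mul hT hs ξ)

theorem nabla_apply (hu : IsMapOn u O) (hξ : IsFieldOn u O ξ) (ht : t ∈ O) {T : HH → HH → HH}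
    {τ : HH →ₗ[ℝ] HH} (hT : HasFrameForm T τ) (X : E) :
    nabla u (fun s => T (u s) (ξ s)) t X =
      T (u t) (nabla u ξ t X) + covDeriv T (u t) (fderiv ℝ u t X) (ξ t) := by
  have hX := hu.isField_fderiv_const X
  have hTξ : ∀ s ∈ O, T (u s) (ξ s) = u s * τ (triv u ξ s) := fun s hs => hu.apply_eq_mul hT hs ξ
  have covDeriv_eq := hT.covDeriv_mul (hu.onS t ht) (hu.isIm_triv hX ht) (hu.isIm_triv hξ ht)
  rw [hu.mul_triv ht, hu.mul_triv ht] at covDeriv_eq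
  rw [covDeriv_eq, hu.nabla_eq (hu.isField_apply hξ hT) ht,
    hu.triv_eq (ξ := fun s => T (u s) (ξ s)) ht (hTξ t ht), hu.fderiv_triv_eq ht hTξ,
    hu.apply_eq_mul hT ht (fun s => nabla u ξ s X), hu.triv_nabla hξ ht,
    fderiv_linearMap_apply τ (hu.differentiableAt_triv hξ ht), ← mul_add, map_add]
  congr 1
  abel

theorem isField_J (hu : IsMapOn u O) (hξ : IsFieldOn u O ξ) :
    IsFieldOn u O (fun s => J (u s) (ξ s)) := hu.isField_apply hξ hasFrameForm_J

theorem isField_P (hu : IsMapOn u O) (hξ : IsFieldOn u O ξ) :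
    IsFieldOn u O (fun s => P (u s) (ξ s)) := hu.isField_apply hξ hasFrameForm_P

theorem isField_PJ (hu : IsMapOn u O) (hξ : IsFieldOn u O ξ) :
    IsFieldOn u O (fun s => PJ (u s) (ξ s)) := hu.isField_apply hξ hasFrameForm_PJ

theorem nabla_J (hu : IsMapOn u O) (hξ : IsFieldOn u O ξ) (ht : t ∈ O) (X : E) :
    nabla u (fun s => J (u s) (ξ s)) t X =
      J (u t) (nabla u ξ t X) + G (u t) (fderiv ℝ u t X) (ξ t) :=
  hu.nabla_apply hξ ht hasFrameForm_J X

theorem nabla_P (hu : IsMapOn u O) (hξ : IsFieldOn u O ξ) (ht : t ∈ O) (X : E) :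
    nabla u (fun s => P (u s) (ξ s)) t X =
      P (u t) (nabla u ξ t X) + covDeriv P (u t) (fderiv ℝ u t X) (ξ t) :=
  hu.nabla_apply hξ ht hasFrameForm_P X

theorem nabla_PJ (hu : IsMapOn u O) (hξ : IsFieldOn u O ξ) (ht : t ∈ O) (X : E) :
    nabla u (fun s => PJ (u s) (ξ s)) t X =
      PJ (u t) (nabla u ξ t X) + covDeriv PJ (u t) (fderiv ℝ u t X) (ξ t) :=
  hu.nabla_apply hξ ht hasFrameForm_PJ X

theorem g_eq_invg (hu : IsMapOn u O) (ht : t ∈ O) (ξ η : E → HH) :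
    g (u t) (ξ t) (η t) = invg (triv u ξ t) (triv u η t) := by
  rw [← g_mul (hu.onS t ht), hu.mul_triv ht, hu.mul_triv ht]

theorem G_eq_mul (hu : IsMapOn u O) (hξ : IsFieldOn u O ξ) (hη : IsFieldOn u O η) (ht : t ∈ O) :
    G (u t) (ξ t) (η t) = u t * invG (triv u ξ t) (triv u η t) := by
  rw [← G_mul (hu.onS t ht) (hu.isIm_triv hξ ht) (hu.isIm_triv hη ht), hu.mul_triv ht,
    hu.mul_triv ht]

theorem isField_G (hu : IsMapOn u O) (hξ : IsFieldOn u O ξ) (hη : IsFieldOn u O η) :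
    IsFieldOn u O (fun s => G (u s) (ξ s) (η s)) :=
  hu.isField_of_eq_mul (contDiffOn_bilinearMap_apply invG (contDiffOn_triv hu.smooth hξ.smooth)
    (contDiffOn_triv hu.smooth hη.smooth)) (fun _ _ => isIm_invG _ _)
    fun _ hs => hu.G_eq_mul hξ hη hs

theorem nabla_G (hu : IsMapOn u O) (hξ : IsFieldOn u O ξ) (hη : IsFieldOn u O η) (ht : t ∈ O)
    (X : E) :
    nabla u (fun s => G (u s) (ξ s) (η s)) t X =
      G (u t) (nabla u ξ t X) (η t) + G (u t) (ξ t) (nabla u η t X) +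
      (1 / 3 : ℝ) • (g (u t) (fderiv ℝ u t X) (η t) • J (u t) (ξ t)
        - g (u t) (fderiv ℝ u t X) (ξ t) • J (u t) (η t)
        - g (u t) (J (u t) (ξ t)) (η t) • fderiv ℝ u t X) := by
  have hX := hu.isField_fderiv_const X
  have hG : ∀ s ∈ O, G (u s) (ξ s) (η s) = u s * invG (triv u ξ s) (triv u η s) :=
    fun s hs => hu.G_eq_mul hξ hη hs
  have frame := invG_covDeriv (hu.isIm_triv hX ht) (hu.isIm_triv hξ ht) (hu.isIm_triv hη ht)
  rw [sub_sub, sub_eq_iff_eq_add] at frame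
  rw [hu.nabla_eq (hu.isField_G hξ hη) ht,
    hu.triv_eq (ξ := fun s => G (u s) (ξ s) (η s)) ht (hG t ht), hu.fderiv_triv_eq ht hG,
    fderiv_bilinearMap_apply invG (hu.differentiableAt_triv hξ ht) (hu.differentiableAt_triv hη ht),
    hu.G_eq_mul (hu.isField_nabla hξ X) hη ht, hu.G_eq_mul hξ (hu.isField_nabla hη X) ht,
    hu.triv_nabla hξ ht, hu.triv_nabla hη ht, hu.g_eq_invg ht (fun s => fderiv ℝ u s X),
    hu.g_eq_invg ht (fun s => fderiv ℝ u s X), hu.g_eq_invg ht (fun s => J (u s) (ξ s)),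
    hu.apply_eq_mul hasFrameForm_J ht, hu.apply_eq_mul hasFrameForm_J ht,
    ← hu.mul_triv ht (fun s => fderiv ℝ u s X),
    hu.triv_eq (ξ := fun s => J (u s) (ξ s)) ht (hu.apply_eq_mul hasFrameForm_J ht ξ), frame]
  simp only [← mul_smul_comm, ← mul_sub, ← mul_add, map_add, LinearMap.add_apply]
  congr 1
  abel

theorem maurerCartan (hu : IsMapOn u O) (ht : t ∈ O) (X Y : E) :
    fderiv ℝ (triv u (fun s => fderiv ℝ u s Y)) t X
        - fderiv ℝ (triv u (fun s => fderiv ℝ u s X)) t Y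
      = -(triv u (fun s => fderiv ℝ u s X) t * triv u (fun s => fderiv ℝ u s Y) t
        - triv u (fun s => fderiv ℝ u s Y) t * triv u (fun s => fderiv ℝ u s X) t) := by
  have torsionFree := hu.nabla_fderiv_comm ht X Y
  rw [hu.nabla_eq (hu.isField_fderiv_const Y) ht, hu.nabla_eq (hu.isField_fderiv_const X) ht]
    at torsionFree
  have in_frame := congrArg (star (u t) * ·) torsionFree
  simp only [(hu.onS t ht).star_mul_mul] at in_frame
  rw [← connForm_sub_swap, neg_sub, sub_eq_sub_iff_add_eq_add, in_frame, add_comm]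

theorem nabla_nabla_eq (hu : IsMapOn u O) (hξ : IsFieldOn u O ξ) (ht : t ∈ O) (X Y : E) :
    nabla u (fun s => nabla u ξ s Y) t X =
      u t * (fderiv ℝ (fun s => fderiv ℝ (triv u ξ) s Y) t X
        + (connForm (fderiv ℝ (triv u (fun s => fderiv ℝ u s Y)) t X) (triv u ξ t)
          + connForm (triv u (fun s => fderiv ℝ u s Y) t) (fderiv ℝ (triv u ξ) t X))
        + connForm (triv u (fun s => fderiv ℝ u s X) t) (fderiv ℝ (triv u ξ) t Y
          + connForm (triv u (fun s => fderiv ℝ u s Y) t) (triv u ξ t))) := by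
  have hY := hu.isField_fderiv_const Y
  have hα := contDiffOn_triv hu.smooth hξ.smooth
  have diff_fderiv : DifferentiableAt ℝ (fun s => fderiv ℝ (triv u ξ) s Y) t :=
    differentiableAt_of_contDiffOn hu.isOpen
      (contDiffOn_fderiv_apply hu.isOpen hα contDiffOn_const) ht
  have diff_connForm : DifferentiableAt ℝ
      (fun s => connForm (triv u (fun s => fderiv ℝ u s Y) s) (triv u ξ s)) t :=
    differentiableAt_of_contDiffOn hu.isOpen
      (contDiffOn_bilinearMap_apply connForm (contDiffOn_triv hu.smooth hY.smooth) hα) ht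
  rw [hu.nabla_eq (hu.isField_nabla hξ Y) ht,
    hu.fderiv_triv_eq ht fun s hs => hu.nabla_eq hξ hs Y, hu.triv_nabla hξ ht Y,
    fderiv_fun_add diff_fderiv diff_connForm, _root_.add_apply,
    fderiv_bilinearMap_apply connForm (hu.differentiableAt_triv hY ht)
      (hu.differentiableAt_triv hξ ht)]

theorem nabla_nabla_sub (hu : IsMapOn u O) (hξ : IsFieldOn u O ξ) (ht : t ∈ O) (X Y : E) :
    nabla u (fun s => nabla u ξ s Y) t X - nabla u (fun s => nabla u ξ s X) t Y =
      curvS (u t) (fderiv ℝ u t X) (fderiv ℝ u t Y) (ξ t) := by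
  have structure_eq := hu.maurerCartan ht X Y
  have in_frame := curvS_mul (hu.onS t ht) (hu.isIm_triv (hu.isField_fderiv_const X) ht)
    (hu.isIm_triv (hu.isField_fderiv_const Y) ht) (hu.isIm_triv hξ ht)
  simp only [hu.mul_triv ht] at in_frame
  rw [in_frame, hu.nabla_nabla_eq hξ ht, hu.nabla_nabla_eq hξ ht,
    fderiv_fderiv_comm hu.isOpen (contDiffOn_triv hu.smooth hξ.smooth) ht X Y, ← mul_sub,
    ← neg_eq_iff_eq_neg.2 structure_eq]
  congr 1
  simp only [map_add, map_neg, map_sub, LinearMap.neg_apply, LinearMap.sub_apply]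
  abel

theorem contDiffOn_g (hu : IsMapOn u O) (hξ : IsFieldOn u O ξ) (hη : IsFieldOn u O η) :
    ContDiffOn ℝ ∞ (fun s => g (u s) (ξ s) (η s)) O := by
  have hα := contDiffOn_triv hu.smooth hξ.smooth
  have hβ := contDiffOn_triv hu.smooth hη.smooth
  have h_invg : ContDiffOn ℝ ∞ (fun s => invg (triv u ξ s) (triv u η s)) O :=
    (contDiffOn_const.mul ((hα.fst.inner ℝ hβ.fst).add (hα.snd.inner ℝ hβ.snd))).sub
      (contDiffOn_const.mul ((hα.fst.inner ℝ hβ.snd).add (hα.snd.inner ℝ hβ.fst)))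
  exact h_invg.congr fun s hs => hu.g_eq_invg hs ξ η

theorem fderiv_g (hu : IsMapOn u O) (hξ : IsFieldOn u O ξ) (hη : IsFieldOn u O η) (ht : t ∈ O)
    (X : E) : fderiv ℝ (fun s => g (u s) (ξ s) (η s)) t X =
      g (u t) (nabla u ξ t X) (η t) + g (u t) (ξ t) (nabla u η t X) :=
  fderiv_g_eq (hu.differentiableAt ht) (differentiableAt_of_contDiffOn hu.isOpen hξ.smooth ht)
    (differentiableAt_of_contDiffOn hu.isOpen hη.smooth ht) ((hu.eventually_mem ht).mono hu.onS)
    ((hu.eventually_mem ht).mono hξ.tangent) ((hu.eventually_mem ht).mono hη.tangent) X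

theorem nabla_add (hu : IsMapOn u O) (hξ : IsFieldOn u O ξ) (hη : IsFieldOn u O η) (ht : t ∈ O)
    (X : E) : nabla u (fun s => ξ s + η s) t X = nabla u ξ t X + nabla u η t X := by
  have hξη : IsFieldOn u O (fun s => ξ s + η s) :=
    ⟨hξ.smooth.add hη.smooth, fun s hs => (hξ.tangent s hs).add (hη.tangent s hs)⟩
  have triv_add : triv u (fun s => ξ s + η s) = fun s => triv u ξ s + triv u η s :=
    funext fun s => mul_add _ _ _
  rw [hu.nabla_eq hξη ht, hu.nabla_eq hξ ht, hu.nabla_eq hη ht, triv_add,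
    fderiv_fun_add (hu.differentiableAt_triv hξ ht) (hu.differentiableAt_triv hη ht), ← mul_add]
  simp only [map_add, _root_.add_apply]
  congr 1
  abel

theorem nabla_congr (hu : IsMapOn u O) (ht : t ∈ O) (h : ∀ s ∈ O, ξ s = η s) (X : E) :
    nabla u ξ t X = nabla u η t X := by
  have eventuallyEq : ξ =ᶠ[nhds t] η := (hu.eventually_mem ht).mono h
  rw [nabla, nabla, eventuallyEq.fderiv_eq, h t ht]

end IsMapOn

end Maps

/-! ### Immersed and Lagrangian submanifolds in local coordinates -/

open scoped Matrix

/-- `u` parametrizes an immersed 3-dimensional submanifold of `𝕊³ × 𝕊³` on the open set `O`. -/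
structure IsImmersionOn (u : E3 → HH) (O : Set E3) : Prop extends IsMapOn u O where
  injective : ∀ s ∈ O, Function.Injective (fderiv ℝ u s)

/-- `u` parametrizes a Lagrangian submanifold of `𝕊³ × 𝕊³` on the open set `O`. -/
structure IsLagrangianOn (u : E3 → HH) (O : Set E3) : Prop extends IsImmersionOn u O where
  lagrangian : ∀ s ∈ O, ∀ w, IsTangent (u s) w →
    ((∃ X, J (u s) (fderiv ℝ u s X) = w) ↔ ∀ Y, g (u s) w (fderiv ℝ u s Y) = 0)

/-- `w` is a normal vector of the submanifold parametrized by `u`. -/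
structure IsNormal (u : E3 → HH) (t : E3) (w : HH) : Prop where
  tangent : IsTangent (u t) w
  g_eq_zero : ∀ Y, g (u t) w (fderiv ℝ u t Y) = 0

/-- The Christoffel symbols of the induced connection: `∇_X Y` for the field with constant
coordinates `Y`. -/
def chr (u : E3 → HH) (t X Y : E3) : E3 := conn u (fun _ => Y) t X

/-- The induced metric in coordinates. -/
def metr (u : E3 → HH) (t X Y : E3) : ℝ := g (u t) (fderiv ℝ u t X) (fderiv ℝ u t Y)

/-- The restriction of `g(P ·, ·)` to the submanifold. -/
def formP (u : E3 → HH) (t X Y : E3) : ℝ :=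
  g (u t) (P (u t) (fderiv ℝ u t X)) (fderiv ℝ u t Y)

/-- The restriction of `g(PJ ·, ·)` to the submanifold. -/
def formPJ (u : E3 → HH) (t X Y : E3) : ℝ :=
  g (u t) (PJ (u t) (fderiv ℝ u t X)) (fderiv ℝ u t Y)

/-- The cubic form `C(X, Y, Z) = g(h(X, Y), J Z)` of a Lagrangian submanifold. -/
def cubic (u : E3 → HH) (t X Y Z : E3) : ℝ := g (u t) (h u t X Y) (J (u t) (fderiv ℝ u t Z))

/-- The tensor `g(h(X, Y), G(Z, W))`. -/
def formHG (u : E3 → HH) (t X Y Z W : E3) : ℝ :=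
  g (u t) (h u t X Y) (G (u t) (fderiv ℝ u t Z) (fderiv ℝ u t W))

theorem sum_coordVec (X : E3) : ∑ i, X i • coordVec i = X := by
  ext j
  fin_cases j <;> simp [coordVec, Fin.sum_univ_three]

theorem g_fderiv_eq_sum (u : E3 → HH) (t : E3) (w : HH) (Y : E3) :
    g (u t) w (fderiv ℝ u t Y) = ∑ i, Y i * g (u t) w (fderiv ℝ u t (coordVec i)) := by
  conv_lhs => rw [← sum_coordVec Y, g_comm, map_sum, g_sum_left]
  exact Finset.sum_congr rfl fun i _ => by rw [map_smul, g_smul_left, g_comm]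

theorem gram_mulVec (u : E3 → HH) (t X : E3) :
    gram u t *ᵥ X.ofLp = fun i => g (u t) (fderiv ℝ u t (coordVec i)) (fderiv ℝ u t X) := by
  ext i
  rw [g_fderiv_eq_sum]
  exact dotProduct_comm (gram u t i) X.ofLp

theorem tang_add (u : E3 → HH) (t : E3) (w w' : HH) :
    tang u t (w + w') = tang u t w + tang u t w' := by
  ext i
  simp [tang, g_add_left, mul_add, Finset.sum_add_distrib]

theorem nabla_fderiv_const (u : E3 → HH) (t X Y : E3) :
    nabla u (fun s => fderiv ℝ u s Y) t X = fderiv ℝ u t (chr u t X Y) + h u t X Y := by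
  rw [h, nor, chr, conn, add_sub_cancel]

theorem metr_comm (u : E3 → HH) (t X Y : E3) : metr u t X Y = metr u t Y X := g_comm _ _ _

theorem cubic_add_right (u : E3 → HH) (t X Y Z Z' : E3) :
    cubic u t X Y (Z + Z') = cubic u t X Y Z + cubic u t X Y Z' := by
  simp only [cubic, map_add, J_add, g_add_right]

namespace IsNormal

variable {u : E3 → HH} {t : E3} {N : HH}

theorem g_fderiv_left (hN : IsNormal u t N) (X : E3) : g (u t) (fderiv ℝ u t X) N = 0 := by
  rw [g_comm, hN.g_eq_zero]

theorem g_nor_left (hN : IsNormal u t N) (w : HH) : g (u t) (nor u t w) N = g (u t) w N := by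
  rw [nor, g_sub_left, hN.g_fderiv_left, sub_zero]

end IsNormal

namespace IsMapOn

variable {u : E3 → HH} {O : Set E3} {t : E3}

theorem nabla_fderiv_field (hu : IsMapOn u O) (ht : t ∈ O) {A : E3 → E3}
    (hA : ContDiffOn ℝ ∞ A O) (X : E3) : nabla u (fun s => fderiv ℝ u s (A s)) t X =
      fderiv ℝ u t (fderiv ℝ A t X) + nabla u (fun s => fderiv ℝ u s (A t)) t X := by
  have hd : DifferentiableAt ℝ (fderiv ℝ u) t :=
    ((hu.smooth.contDiffAt (hu.isOpen.mem_nhds ht)).fderiv_right (m := 1)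
      (by norm_cast)).differentiableAt (by norm_num)
  have tanProj_add (w : HH) : tanProj (u t) (fderiv ℝ u t (fderiv ℝ A t X) + w) =
      fderiv ℝ u t (fderiv ℝ A t X) + tanProj (u t) w := by
    have htan := hu.isTangent_fderiv ht (fderiv ℝ A t X)
    ext1 <;> simp only [tanProj, Prod.fst_add, Prod.snd_add, inner_add_right, htan.1, htan.2,
      zero_add, add_sub_assoc]
  simp only [nabla, fderiv_clm_apply hd (differentiableAt_of_contDiffOn hu.isOpen hA ht),
    fderiv_clm_apply hd (differentiableAt_const _), _root_.add_apply,
    ContinuousLinearMap.comp_apply, ContinuousLinearMap.flip_apply, fderiv_fun_const, Pi.zero_apply,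
    _root_.zero_apply, map_zero, zero_add, tanProj_add, add_assoc]

theorem chr_comm (hu : IsMapOn u O) (ht : t ∈ O) (X Y : E3) : chr u t X Y = chr u t Y X := by
  simp only [chr, conn, hu.nabla_fderiv_comm ht X Y]

theorem h_comm (hu : IsMapOn u O) (ht : t ∈ O) (X Y : E3) : h u t X Y = h u t Y X := by
  simp only [h, hu.nabla_fderiv_comm ht X Y]

theorem chr_add_right (hu : IsMapOn u O) (ht : t ∈ O) (X Y Y' : E3) :
    chr u t X (Y + Y') = chr u t X Y + chr u t X Y' := by
  simp only [chr, conn, map_add]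
  rw [hu.nabla_add (hu.isField_fderiv_const Y) (hu.isField_fderiv_const Y') ht, tang_add]

theorem cubic_swap_left (hu : IsMapOn u O) (ht : t ∈ O) (X Y Z : E3) :
    cubic u t X Y Z = cubic u t Y X Z := by rw [cubic, cubic, hu.h_comm ht]

end IsMapOn

namespace IsImmersionOn

variable {u ξ : E3 → HH} {O : Set E3} {t : E3}

theorem eq_zero_of_g_fderiv_self (hu : IsImmersionOn u O) (ht : t ∈ O) {X : E3}
    (hX : g (u t) (fderiv ℝ u t X) (fderiv ℝ u t X) = 0) : X = 0 := by
  refine hu.injective t ht ?_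
  rw [map_zero]
  by_contra hne
  exact (g_self_pos (hu.onS t ht) hne).ne' hX

theorem det_gram_ne_zero (hu : IsImmersionOn u O) (ht : t ∈ O) : (gram u t).det ≠ 0 := by
  intro det_eq_zero
  obtain ⟨v, v_ne_zero, gram_v⟩ := Matrix.exists_mulVec_eq_zero_iff.2 det_eq_zero
  let X : E3 := WithLp.toLp 2 v
  have g_coordVec (i : Fin 3) : g (u t) (fderiv ℝ u t X) (fderiv ℝ u t (coordVec i)) = 0 := by
    rw [g_comm]
    exact congrFun ((gram_mulVec u t X).symm.trans gram_v) i
  have X_eq_zero : X = 0 := hu.eq_zero_of_g_fderiv_self ht <| by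
    rw [g_fderiv_eq_sum]
    exact Finset.sum_eq_zero fun i _ => by rw [g_coordVec, mul_zero]
  exact v_ne_zero (congrArg WithLp.ofLp X_eq_zero)

theorem contDiffOn_gram (hu : IsImmersionOn u O) (i j : Fin 3) :
    ContDiffOn ℝ ∞ (fun s => gram u s i j) O :=
  hu.contDiffOn_g (hu.isField_fderiv_const _) (hu.isField_fderiv_const _)

theorem contDiffOn_gram_inv (hu : IsImmersionOn u O) (i j : Fin 3) :
    ContDiffOn ℝ ∞ (fun s => (gram u s)⁻¹ i j) O := by
  have hg := hu.contDiffOn_gram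
  have hdet : ContDiffOn ℝ ∞ (fun s => (gram u s).det) O := by
    simp only [Matrix.det_fin_three]
    fun_prop
  have hadj : ContDiffOn ℝ ∞ (fun s => (gram u s).adjugate i j) O := by
    simp only [Matrix.adjugate_apply, Matrix.det_fin_three, Matrix.updateRow_apply, Pi.single_apply]
    split_ifs <;> fun_prop
  refine ((hdet.inv fun s hs => hu.det_gram_ne_zero hs).mul hadj).congr fun s _ => ?_
  simp [Matrix.inv_def]

theorem contDiffOn_tang (hu : IsImmersionOn u O) (hξ : IsFieldOn u O ξ) :
    ContDiffOn ℝ ∞ (fun s => tang u s (ξ s)) O := by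
  rw [contDiffOn_euclidean]
  intro i
  simp only [tang]
  exact ContDiffOn.sum fun j _ =>
    (hu.contDiffOn_gram_inv i j).mul (hu.contDiffOn_g hξ (hu.isField_fderiv_const _))

theorem g_fderiv_tang (hu : IsImmersionOn u O) (ht : t ∈ O) (w : HH) (Y : E3) :
    g (u t) (fderiv ℝ u t (tang u t w)) (fderiv ℝ u t Y) = g (u t) w (fderiv ℝ u t Y) := by
  have gram_mulVec_tang : gram u t *ᵥ (tang u t w).ofLp =
      fun i => g (u t) w (fderiv ℝ u t (coordVec i)) := by
    change gram u t *ᵥ ((gram u t)⁻¹ *ᵥ fun i => g (u t) w (fderiv ℝ u t (coordVec i))) = _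
    rw [Matrix.mulVec_mulVec, Matrix.mul_nonsing_inv _ (hu.det_gram_ne_zero ht).isUnit,
      Matrix.one_mulVec]
  rw [g_fderiv_eq_sum, g_fderiv_eq_sum u t w]
  refine Finset.sum_congr rfl fun i _ => ?_
  rw [g_comm, ← congrFun gram_mulVec_tang i, gram_mulVec]

theorem tang_eq (hu : IsImmersionOn u O) (ht : t ∈ O) {w : HH} {A : E3}
    (hA : ∀ Y, g (u t) w (fderiv ℝ u t Y) = g (u t) (fderiv ℝ u t A) (fderiv ℝ u t Y)) :
    tang u t w = A := by
  rw [← sub_eq_zero]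
  refine hu.eq_zero_of_g_fderiv_self ht ?_
  conv_lhs => enter [2]; rw [map_sub]
  rw [g_sub_left, hu.g_fderiv_tang ht, hA, sub_self]

theorem tang_fderiv (hu : IsImmersionOn u O) (ht : t ∈ O) (X : E3) :
    tang u t (fderiv ℝ u t X) = X := hu.tang_eq ht fun _ => rfl

theorem isNormal_nor (hu : IsImmersionOn u O) (ht : t ∈ O) {w : HH} (hw : IsTangent (u t) w) :
    IsNormal u t (nor u t w) :=
  ⟨hw.sub (hu.isTangent_fderiv ht _), fun Y => by
    rw [nor, g_sub_left, hu.g_fderiv_tang ht, sub_self]⟩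

theorem isField_nor (hu : IsImmersionOn u O) (hξ : IsFieldOn u O ξ) :
    IsFieldOn u O (fun s => nor u s (ξ s)) :=
  ⟨hξ.smooth.sub (contDiffOn_fderiv_apply hu.isOpen hu.smooth (hu.contDiffOn_tang hξ)),
    fun s hs => (hu.isNormal_nor hs (hξ.tangent s hs)).tangent⟩

theorem conn_eq (hu : IsImmersionOn u O) (ht : t ∈ O) {A : E3 → E3}
    (hA : ContDiffOn ℝ ∞ A O) (X : E3) :
    conn u A t X = fderiv ℝ A t X + chr u t X (A t) := by
  rw [conn, hu.nabla_fderiv_field ht hA, tang_add, hu.tang_fderiv ht, chr, conn]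

theorem nabla_fderiv_eq (hu : IsImmersionOn u O) (ht : t ∈ O) {A : E3 → E3}
    (hA : ContDiffOn ℝ ∞ A O) (X : E3) : nabla u (fun s => fderiv ℝ u s (A s)) t X =
      fderiv ℝ u t (conn u A t X) + h u t X (A t) := by
  rw [hu.nabla_fderiv_field ht hA, nabla_fderiv_const, hu.conn_eq ht hA, map_add, add_assoc]

theorem contDiffOn_chr (hu : IsImmersionOn u O) (X Y : E3) :
    ContDiffOn ℝ ∞ (fun s => chr u s X Y) O :=
  hu.contDiffOn_tang (hu.isField_nabla (hu.isField_fderiv_const Y) X)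

theorem isField_h (hu : IsImmersionOn u O) (X Y : E3) : IsFieldOn u O (fun s => h u s X Y) :=
  hu.isField_nor (hu.isField_nabla (hu.isField_fderiv_const Y) X)

theorem isNormal_h (hu : IsImmersionOn u O) (ht : t ∈ O) (X Y : E3) : IsNormal u t (h u t X Y) :=
  hu.isNormal_nor ht ((hu.isField_nabla (hu.isField_fderiv_const Y) X).tangent t ht)

theorem contDiffOn_cubic (hu : IsImmersionOn u O) (X Y Z : E3) :
    ContDiffOn ℝ ∞ (fun s => cubic u s X Y Z) O :=
  hu.contDiffOn_g (hu.isField_h X Y) (hu.isField_J (hu.isField_fderiv_const Z))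

end IsImmersionOn

theorem IsNormal.exists_eq_J {u : E3 → HH} {O : Set E3} {t : E3} {N : HH} (hN : IsNormal u t N)
    (hu : IsLagrangianOn u O) (ht : t ∈ O) : ∃ X, J (u t) (fderiv ℝ u t X) = N :=
  (hu.lagrangian t ht N hN.tangent).2 hN.g_eq_zero

namespace IsLagrangianOn

variable {u : E3 → HH} {O : Set E3} {t : E3}

theorem isNormal_J (hu : IsLagrangianOn u O) (ht : t ∈ O) (X : E3) :
    IsNormal u t (J (u t) (fderiv ℝ u t X)) :=
  have tangent := isTangent_J (hu.onS t ht) (hu.isTangent_fderiv ht X)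
  ⟨tangent, (hu.lagrangian t ht _ tangent).1 ⟨X, rfl⟩⟩

theorem g_J_fderiv (hu : IsLagrangianOn u O) (ht : t ∈ O) (X Y : E3) :
    g (u t) (J (u t) (fderiv ℝ u t X)) (fderiv ℝ u t Y) = 0 := (hu.isNormal_J ht X).g_eq_zero Y

theorem g_normal_J_normal (hu : IsLagrangianOn u O) (ht : t ∈ O) {N N' : HH} (hN : IsNormal u t N)
    (hN' : IsNormal u t N') : g (u t) N (J (u t) N') = 0 := by
  obtain ⟨X, rfl⟩ := hN'.exists_eq_J hu ht
  rw [J_J (hu.onS t ht), g_neg_right, hN.g_eq_zero, neg_zero]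

theorem cubic_sub_swap (hu : IsLagrangianOn u O) (ht : t ∈ O) (X Y Z : E3) :
    cubic u t X Y Z - cubic u t X Z Y =
      -g (u t) (fderiv ℝ u t Y) (G (u t) (fderiv ℝ u t X) (fderiv ℝ u t Z)) := by
  have hY := hu.isField_fderiv_const Y
  have hZ := hu.isField_fderiv_const Z
  have deriv_zero := fderiv_apply_eq_zero_of_const_on hu.isOpen
    (fun s hs => (hu.isNormal_J hs Z).g_fderiv_left Y) ht X
  rw [hu.fderiv_g hY (hu.isField_J hZ) ht, hu.nabla_J hZ ht, nabla_fderiv_const,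
    nabla_fderiv_const, g_add_left, (hu.isNormal_J ht Z).g_fderiv_left, J_add, g_add_right,
    g_add_right, (hu.isNormal_J ht _).g_fderiv_left, g_comm _ _ (J _ (h _ _ _ _)),
    g_J_left (hu.onS t ht)] at deriv_zero
  rw [cubic, cubic]
  linarith

/-- `σ(X, Y, Z) = g(Y, G(X, Z))` is totally skew, while `C(X, Y, Z) - C(X, Z, Y) = -σ(X, Y, Z)`
with `C` symmetric in its first two arguments; summing cyclically gives `3 σ = 0`. -/
theorem isNormal_G (hu : IsLagrangianOn u O) (ht : t ∈ O) (X Y : E3) :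
    IsNormal u t (G (u t) (fderiv ℝ u t X) (fderiv ℝ u t Y)) := by
  have hS := hu.onS t ht
  have hd := hu.isTangent_fderiv ht
  refine ⟨isTangent_G hS (hd X) (hd Y), fun Z => ?_⟩
  let σ (X Y Z : E3) : ℝ := g (u t) (fderiv ℝ u t Y) (G (u t) (fderiv ℝ u t X) (fderiv ℝ u t Z))
  have skew_right (X Y Z : E3) : σ X Y Z = -σ X Z Y := by
    simp only [σ]
    rw [g_comm, g_G_left hS (hd X) (hd Z) (hd Y)]
  have skew_outer (X Y Z : E3) : σ X Y Z = -σ Z Y X := by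
    simp only [σ]
    rw [G_antisymm hS (hd X) (hd Z), g_neg_right]
  have cubic_sub (X Y Z : E3) : cubic u t X Y Z - cubic u t X Z Y = -σ X Y Z :=
    hu.cubic_sub_swap ht X Y Z
  rw [g_comm]
  change σ X Z Y = 0
  linarith [cubic_sub X Y Z, cubic_sub Y Z X, cubic_sub Z X Y, hu.cubic_swap_left ht X Y Z,
    hu.cubic_swap_left ht Y Z X, hu.cubic_swap_left ht Z X Y, skew_right X Y Z, skew_right Y Z X,
    skew_right Z X Y, skew_outer X Y Z, skew_outer Y Z X, skew_outer Z X Y]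

theorem cubic_swap_right (hu : IsLagrangianOn u O) (ht : t ∈ O) (X Y Z : E3) :
    cubic u t X Y Z = cubic u t X Z Y := by
  rw [← sub_eq_zero, hu.cubic_sub_swap ht, (hu.isNormal_G ht X Z).g_fderiv_left, neg_zero]

theorem formHG_cyclic (hu : IsLagrangianOn u O) (ht : t ∈ O) (W X Y Z : E3) :
    formHG u t W X Y Z + formHG u t W Y Z X + formHG u t W Z X Y = 0 := by
  have hS := hu.onS t ht
  have hd := hu.isTangent_fderiv ht
  have hh := fun X Y => (hu.isNormal_h ht X Y).tangent
  have hX := hu.isField_fderiv_const X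
  have hY := hu.isField_fderiv_const Y
  have hZ := hu.isField_fderiv_const Z
  have deriv_zero := fderiv_apply_eq_zero_of_const_on hu.isOpen
    (fun s hs => (hu.isNormal_G hs X Y).g_fderiv_left Z) ht W
  rw [hu.fderiv_g hZ (hu.isField_G hX hY) ht, hu.nabla_G hX hY ht, nabla_fderiv_const,
    nabla_fderiv_const, nabla_fderiv_const, G_add_left hS (hd _) (hh _ _) (hd _),
    G_add_right hS (hd _) (hd _) (hh _ _), hu.g_J_fderiv ht] at deriv_zero
  simp only [g_add_left, g_add_right, g_smul_right, g_sub_right,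
    (hu.isNormal_G ht _ _).g_fderiv_left, (hu.isNormal_J ht _).g_fderiv_left] at deriv_zero
  have first_slot : g (u t) (fderiv ℝ u t Z) (G (u t) (h u t W X) (fderiv ℝ u t Y)) =
      formHG u t W X Y Z := by
    rw [G_antisymm hS (hh _ _) (hd _), g_neg_right, g_comm, g_G_left hS (hd _) (hh _ _) (hd _),
      neg_neg, formHG]
  have second_slot : g (u t) (fderiv ℝ u t Z) (G (u t) (fderiv ℝ u t X) (h u t W Y)) =
      formHG u t W Y Z X := by
    rw [g_comm, g_G_left hS (hd _) (hh _ _) (hd _), G_antisymm hS (hd X) (hd Z), g_neg_right,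
      neg_neg, formHG]
  rw [first_slot, second_slot, ← formHG] at deriv_zero
  linarith

end IsLagrangianOn

/-! ### The equations of Codazzi and Ricci -/

/-- `ξ` is a smooth normal vector field of the submanifold parametrized by `u` on `O`. -/
structure IsNormalFieldOn (u : E3 → HH) (O : Set E3) (ξ : E3 → HH) : Prop
    extends IsFieldOn u O ξ where
  g_eq_zero : ∀ s ∈ O, ∀ Y, g (u s) (ξ s) (fderiv ℝ u s Y) = 0

theorem IsNormalFieldOn.isNormal {u ξ : E3 → HH} {O : Set E3} {t : E3}
    (hξ : IsNormalFieldOn u O ξ) (ht : t ∈ O) : IsNormal u t (ξ t) :=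
  ⟨hξ.tangent t ht, hξ.g_eq_zero t ht⟩

theorem nablaH_eq (u : E3 → HH) (t X Y Z : E3) :
    nablaH u t X Y Z = normalConn u (fun s => h u s Y Z) t X - h u t (chr u t X Y) Z
      - h u t Y (chr u t X Z) := rfl

namespace IsImmersionOn

variable {u ξ : E3 → HH} {O : Set E3} {t : E3}

theorem isNormalField_nor (hu : IsImmersionOn u O) (hξ : IsFieldOn u O ξ) :
    IsNormalFieldOn u O (fun s => nor u s (ξ s)) :=
  ⟨hu.isField_nor hξ, fun s hs => (hu.isNormal_nor hs (hξ.tangent s hs)).g_eq_zero⟩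

theorem isNormalField_h (hu : IsImmersionOn u O) (X Y : E3) :
    IsNormalFieldOn u O (fun s => h u s X Y) :=
  hu.isNormalField_nor (hu.isField_nabla (hu.isField_fderiv_const Y) X)

theorem isNormalField_normalConn (hu : IsImmersionOn u O) (hξ : IsFieldOn u O ξ) (X : E3) :
    IsNormalFieldOn u O (fun s => normalConn u ξ s X) :=
  hu.isNormalField_nor (hu.isField_nabla hξ X)

theorem curv_eq (hu : IsImmersionOn u O) (ht : t ∈ O) (X Y Z : E3) :
    curv u t X Y Z = fderiv ℝ (fun s => chr u s Y Z) t X + chr u t X (chr u t Y Z)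
      - (fderiv ℝ (fun s => chr u s X Z) t Y + chr u t Y (chr u t X Z)) := by
  rw [← hu.conn_eq ht (hu.contDiffOn_chr Y Z) X, ← hu.conn_eq ht (hu.contDiffOn_chr X Z) Y]
  rfl

theorem g_nabla_nabla_fderiv (hu : IsImmersionOn u O) (ht : t ∈ O) (X Y Z : E3) {N : HH}
    (hN : IsNormal u t N) :
    g (u t) (nabla u (fun s => nabla u (fun s => fderiv ℝ u s Z) s Y) t X) N =
      g (u t) (h u t X (chr u t Y Z)) N + g (u t) (normalConn u (fun s => h u s Y Z) t X) N := by
  have hc := hu.contDiffOn_chr Y Z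
  rw [hu.nabla_congr (ξ := fun s => nabla u (fun s => fderiv ℝ u s Z) s Y)
    (η := fun s => fderiv ℝ u s (chr u s Y Z) + h u s Y Z) ht
    (fun s _ => nabla_fderiv_const u s Y Z), hu.nabla_add (hu.isField_fderiv hc) (hu.isField_h Y Z)
    ht, hu.nabla_fderiv_eq ht hc, g_add_left, g_add_left, hN.g_fderiv_left, zero_add, normalConn,
    hN.g_nor_left]

theorem codazzi (hu : IsImmersionOn u O) (ht : t ∈ O) (X Y Z : E3) {N : HH}
    (hN : IsNormal u t N) : g (u t) (nablaH u t X Y Z) N - g (u t) (nablaH u t Y X Z) N =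
      g (u t) (curvS (u t) (fderiv ℝ u t X) (fderiv ℝ u t Y) (fderiv ℝ u t Z)) N := by
  rw [← hu.nabla_nabla_sub (hu.isField_fderiv_const Z) ht, g_sub_left,
    hu.g_nabla_nabla_fderiv ht X Y Z hN, hu.g_nabla_nabla_fderiv ht Y X Z hN]
  simp only [nablaH_eq, g_sub_left]
  rw [hu.chr_comm ht Y X]
  ring

end IsImmersionOn

namespace IsLagrangianOn

variable {u ξ : E3 → HH} {O : Set E3} {t : E3}

theorem g_curvS (hu : IsLagrangianOn u O) (ht : t ∈ O) (X Y Z : E3) {N : HH}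
    (hN : IsNormal u t N) :
    3 * g (u t) (curvS (u t) (fderiv ℝ u t X) (fderiv ℝ u t Y) (fderiv ℝ u t Z)) N =
      formP u t Y Z * g (u t) (P (u t) (fderiv ℝ u t X)) N
      - formP u t X Z * g (u t) (P (u t) (fderiv ℝ u t Y)) N
      + formPJ u t Y Z * g (u t) (PJ (u t) (fderiv ℝ u t X)) N
      - formPJ u t X Z * g (u t) (PJ (u t) (fderiv ℝ u t Y)) N := by
  simp only [curvS, hu.g_J_fderiv ht, g_add_left, g_sub_left, g_smul_left, hN.g_fderiv_left,
    J_P (hu.onS t ht), g_neg_left, formP, formPJ]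
  ring

theorem g_G_normal_normal (hu : IsLagrangianOn u O) (ht : t ∈ O) {N N' : HH} (V : E3)
    (hN : IsNormal u t N) (hN' : IsNormal u t N') :
    g (u t) N (G (u t) (fderiv ℝ u t V) N') = 0 := by
  have hS := hu.onS t ht
  obtain ⟨A, rfl⟩ := hN.exists_eq_J hu ht
  obtain ⟨B, rfl⟩ := hN'.exists_eq_J hu ht
  rw [G_J hS (hu.isTangent_fderiv ht V) (hu.isTangent_fderiv ht B), g_neg_right, g_J_J hS,
    (hu.isNormal_G ht V B).g_fderiv_left, neg_zero]

theorem fderiv_g_J (hu : IsLagrangianOn u O) (hξ : IsNormalFieldOn u O ξ) (ht : t ∈ O)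
    {A : E3 → E3} (hA : ContDiffOn ℝ ∞ A O) (X : E3) :
    fderiv ℝ (fun s => g (u s) (ξ s) (J (u s) (fderiv ℝ u s (A s)))) t X =
      g (u t) (normalConn u ξ t X) (J (u t) (fderiv ℝ u t (A t)))
      + g (u t) (ξ t) (J (u t) (fderiv ℝ u t (fderiv ℝ A t X)))
      + g (u t) (ξ t) (J (u t) (fderiv ℝ u t (chr u t X (A t))))
      + g (u t) (ξ t) (G (u t) (fderiv ℝ u t X) (fderiv ℝ u t (A t))) := by
  have hd := hu.isField_fderiv hA
  rw [hu.fderiv_g hξ.toIsFieldOn (hu.isField_J hd) ht, hu.nabla_J hd ht, hu.nabla_fderiv_eq ht hA,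
    hu.conn_eq ht hA, map_add, normalConn, (hu.isNormal_J ht _).g_nor_left]
  simp only [J_add, g_add_right]
  rw [hu.g_normal_J_normal ht (hξ.isNormal ht) (hu.isNormal_h ht _ _)]
  ring

theorem fderiv_g_J_const (hu : IsLagrangianOn u O) (hξ : IsNormalFieldOn u O ξ) (ht : t ∈ O)
    (X V : E3) :
    fderiv ℝ (fun s => g (u s) (ξ s) (J (u s) (fderiv ℝ u s V))) t X =
      g (u t) (normalConn u ξ t X) (J (u t) (fderiv ℝ u t V))
      + g (u t) (ξ t) (J (u t) (fderiv ℝ u t (chr u t X V)))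
      + g (u t) (ξ t) (G (u t) (fderiv ℝ u t X) (fderiv ℝ u t V)) := by
  rw [hu.fderiv_g_J hξ ht contDiffOn_const, fderiv_fun_const, Pi.zero_apply, _root_.zero_apply,
    map_zero, J_zero, g_zero_right, add_zero]

theorem fderiv_g_G (hu : IsLagrangianOn u O) (hξ : IsNormalFieldOn u O ξ) (ht : t ∈ O)
    (X Y V : E3) :
    fderiv ℝ (fun s => g (u s) (ξ s) (G (u s) (fderiv ℝ u s Y) (fderiv ℝ u s V))) t X =
      g (u t) (normalConn u ξ t X) (G (u t) (fderiv ℝ u t Y) (fderiv ℝ u t V))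
      + g (u t) (ξ t) (G (u t) (fderiv ℝ u t (chr u t X Y)) (fderiv ℝ u t V))
      + g (u t) (ξ t) (G (u t) (fderiv ℝ u t Y) (fderiv ℝ u t (chr u t X V)))
      + 1 / 3 * (metr u t X V * g (u t) (ξ t) (J (u t) (fderiv ℝ u t Y))
        - metr u t X Y * g (u t) (ξ t) (J (u t) (fderiv ℝ u t V))) := by
  have hS := hu.onS t ht
  have hd := hu.isTangent_fderiv ht
  have hh := hu.isNormal_h ht
  have hN := hξ.isNormal ht
  have hY := hu.isField_fderiv_const Y
  have hV := hu.isField_fderiv_const V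
  rw [hu.fderiv_g hξ.toIsFieldOn (hu.isField_G hY hV) ht, hu.nabla_G hY hV ht,
    nabla_fderiv_const, nabla_fderiv_const, G_add_left hS (hd _) (hh _ _).tangent (hd _),
    G_add_right hS (hd _) (hd _) (hh _ _).tangent, hu.g_J_fderiv ht, normalConn,
    (hu.isNormal_G ht Y V).g_nor_left, G_antisymm hS (hh X Y).tangent (hd V)]
  simp only [g_add_right, g_smul_right, g_sub_right, g_neg_right,
    hu.g_G_normal_normal ht _ hN (hh _ _), hN.g_eq_zero, metr]
  ring

theorem g_normalConn_normalConn_J (hu : IsLagrangianOn u O) (hξ : IsNormalFieldOn u O ξ)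
    (ht : t ∈ O) (X Y V : E3) :
    g (u t) (normalConn u (fun s => normalConn u ξ s Y) t X) (J (u t) (fderiv ℝ u t V)) =
      fderiv ℝ (fun s => fderiv ℝ (fun s => g (u s) (ξ s) (J (u s) (fderiv ℝ u s V))) s Y) t X
      - fderiv ℝ (fun s => g (u s) (ξ s) (J (u s) (fderiv ℝ u s (chr u s Y V)))) t X
      - fderiv ℝ (fun s => g (u s) (ξ s) (G (u s) (fderiv ℝ u s Y) (fderiv ℝ u s V))) t X
      - g (u t) (normalConn u ξ t Y) (J (u t) (fderiv ℝ u t (chr u t X V)))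
      - g (u t) (normalConn u ξ t Y) (G (u t) (fderiv ℝ u t X) (fderiv ℝ u t V)) := by
  have hV := hu.isField_fderiv_const V
  have hξJ : ContDiffOn ℝ ∞ (fun s => g (u s) (ξ s) (J (u s) (fderiv ℝ u s V))) O :=
    hu.contDiffOn_g hξ.toIsFieldOn (hu.isField_J hV)
  have diff_fderiv := differentiableAt_of_contDiffOn hu.isOpen
    (contDiffOn_fderiv_apply hu.isOpen hξJ (contDiffOn_const (c := Y))) ht
  have diff_J := differentiableAt_of_contDiffOn hu.isOpen (hu.contDiffOn_g hξ.toIsFieldOn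
    (hu.isField_J (hu.isField_fderiv (hu.contDiffOn_chr Y V)))) ht
  have diff_G := differentiableAt_of_contDiffOn hu.isOpen (hu.contDiffOn_g hξ.toIsFieldOn
    (hu.isField_G (hu.isField_fderiv_const Y) hV)) ht
  have normalConn_J : ∀ s ∈ O, g (u s) (normalConn u ξ s Y) (J (u s) (fderiv ℝ u s V)) =
      fderiv ℝ (fun s => g (u s) (ξ s) (J (u s) (fderiv ℝ u s V))) s Y
      - g (u s) (ξ s) (J (u s) (fderiv ℝ u s (chr u s Y V)))
      - g (u s) (ξ s) (G (u s) (fderiv ℝ u s Y) (fderiv ℝ u s V)) := fun s hs => by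
    rw [hu.fderiv_g_J_const hξ hs]
    ring
  have deriv_normalConn_J := hu.fderiv_g_J_const
    (hu.isNormalField_normalConn hξ.toIsFieldOn Y) ht X V
  rw [fderiv_congr_of_eqOn hu.isOpen normalConn_J ht,
    fderiv_fun_sub (diff_fderiv.fun_sub diff_J) diff_G, fderiv_fun_sub diff_fderiv diff_J,
    _root_.sub_apply, _root_.sub_apply] at deriv_normalConn_J
  linarith

theorem ricci (hu : IsLagrangianOn u O) (hξ : IsNormalFieldOn u O ξ) (ht : t ∈ O)
    (X Y V : E3) :
    g (u t) (normalCurv u ξ t X Y) (J (u t) (fderiv ℝ u t V)) =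
      -g (u t) (ξ t) (J (u t) (fderiv ℝ u t (curv u t X Y V)))
      - 1 / 3 * (metr u t X V * g (u t) (ξ t) (J (u t) (fderiv ℝ u t Y))
        - metr u t Y V * g (u t) (ξ t) (J (u t) (fderiv ℝ u t X))) := by
  have hξJ := hu.contDiffOn_g hξ.toIsFieldOn (hu.isField_J (hu.isField_fderiv_const V))
  rw [normalCurv, g_sub_left, hu.g_normalConn_normalConn_J hξ ht X Y,
    hu.g_normalConn_normalConn_J hξ ht Y X, fderiv_fderiv_comm hu.isOpen hξJ ht X Y,
    hu.fderiv_g_J hξ ht (hu.contDiffOn_chr Y V), hu.fderiv_g_J hξ ht (hu.contDiffOn_chr X V),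
    hu.fderiv_g_G hξ ht X Y, hu.fderiv_g_G hξ ht Y X, hu.curv_eq ht, hu.chr_comm ht Y X,
    metr_comm u t Y X]
  simp only [map_add, map_sub, J_add, J_sub, g_add_right, g_sub_right]
  ring

end IsLagrangianOn

/-! ### The covariant derivatives of the cubic form -/

/-- The covariant derivative `(∇_X C)(Y, Z, W)` of the cubic form. -/
def covCubic (u : E3 → HH) (t X Y Z W : E3) : ℝ :=
  fderiv ℝ (fun s => cubic u s Y Z W) t X - cubic u t (chr u t X Y) Z W
    - cubic u t Y (chr u t X Z) W - cubic u t Y Z (chr u t X W)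

/-- The second covariant derivative `(∇²_{X,Y} C)(Z, W, V)` of the cubic form. -/
def cov2Cubic (u : E3 → HH) (t X Y Z W V : E3) : ℝ :=
  fderiv ℝ (fun s => covCubic u s Y Z W V) t X - covCubic u t (chr u t X Y) Z W V
    - covCubic u t Y (chr u t X Z) W V - covCubic u t Y Z (chr u t X W) V
    - covCubic u t Y Z W (chr u t X V)

theorem IsImmersionOn.contDiffOn_cubic_field {u : E3 → HH} {O : Set E3} (hu : IsImmersionOn u O)
    {A : E3 → E3} (hA : ContDiffOn ℝ ∞ A O) (Y Z : E3) :
    ContDiffOn ℝ ∞ (fun s => cubic u s Y Z (A s)) O :=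
  hu.contDiffOn_g (hu.isField_h Y Z) (hu.isField_J (hu.isField_fderiv hA))

namespace IsLagrangianOn

variable {u : E3 → HH} {O : Set E3} {t : E3}

theorem covCubic_eq (hu : IsLagrangianOn u O) (ht : t ∈ O) (X Y Z W : E3) :
    covCubic u t X Y Z W =
      g (u t) (nablaH u t X Y Z) (J (u t) (fderiv ℝ u t W)) + formHG u t Y Z X W := by
  have deriv_cubic := hu.fderiv_g_J_const (hu.isNormalField_h Y Z) ht X W
  simp only [covCubic, cubic, formHG, nablaH_eq, g_sub_left, deriv_cubic]
  ring

theorem cubic_rotate (hu : IsLagrangianOn u O) (ht : t ∈ O) (X Y Z : E3) :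
    cubic u t X Y Z = cubic u t Y Z X := by
  rw [hu.cubic_swap_left ht, hu.cubic_swap_right ht]

theorem cubic_add_left (hu : IsLagrangianOn u O) (ht : t ∈ O) (X X' Y Z : E3) :
    cubic u t (X + X') Y Z = cubic u t X Y Z + cubic u t X' Y Z := by
  simp only [hu.cubic_rotate ht _ Y Z, cubic_add_right]

theorem cubic_add_mid (hu : IsLagrangianOn u O) (ht : t ∈ O) (X Y Y' Z : E3) :
    cubic u t X (Y + Y') Z = cubic u t X Y Z + cubic u t X Y' Z := by
  simp only [hu.cubic_swap_right ht X _ Z, cubic_add_right]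

theorem covCubic_swap_left (hu : IsLagrangianOn u O) (ht : t ∈ O) (X Y Z W : E3) :
    covCubic u t X Y Z W = covCubic u t X Z Y W := by
  rw [covCubic, covCubic,
    fderiv_congr_of_eqOn hu.isOpen (fun s hs => hu.cubic_swap_left hs Y Z W) ht,
    hu.cubic_swap_left ht (chr u t X Y), hu.cubic_swap_left ht Y, hu.cubic_swap_left ht Y Z]
  ring

theorem covCubic_swap_right (hu : IsLagrangianOn u O) (ht : t ∈ O) (X Y Z W : E3) :
    covCubic u t X Y Z W = covCubic u t X Y W Z := by
  rw [covCubic, covCubic,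
    fderiv_congr_of_eqOn hu.isOpen (fun s hs => hu.cubic_swap_right hs Y Z W) ht,
    hu.cubic_swap_right ht (chr u t X Y), hu.cubic_swap_right ht Y, hu.cubic_swap_right ht Y Z]
  ring

theorem covCubic_add_right (hu : IsLagrangianOn u O) (ht : t ∈ O) (X Y Z W W' : E3) :
    covCubic u t X Y Z (W + W') = covCubic u t X Y Z W + covCubic u t X Y Z W' := by
  simp only [covCubic, hu.chr_add_right ht, cubic_add_right]
  rw [fderiv_fun_add (differentiableAt_of_contDiffOn hu.isOpen (hu.contDiffOn_cubic Y Z W) ht)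
    (differentiableAt_of_contDiffOn hu.isOpen (hu.contDiffOn_cubic Y Z W') ht),
    _root_.add_apply]
  ring

theorem covCubic_add_left (hu : IsLagrangianOn u O) (ht : t ∈ O) (X X' Y Z W : E3) :
    covCubic u t (X + X') Y Z W = covCubic u t X Y Z W + covCubic u t X' Y Z W := by
  have chr_add_left (A : E3) : chr u t (X + X') A = chr u t X A + chr u t X' A := by
    rw [hu.chr_comm ht, hu.chr_add_right ht, hu.chr_comm ht, hu.chr_comm ht A]
  simp only [covCubic, chr_add_left, map_add, cubic_add_right, hu.cubic_add_left ht,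
    hu.cubic_add_mid ht]
  ring

theorem covCubic_eq_chr_right (hu : IsLagrangianOn u O) (ht : t ∈ O) (X Y Z W : E3) :
    covCubic u t X Y Z W = fderiv ℝ (fun s => cubic u s Y Z W) t X
      - cubic u t Z W (chr u t X Y) - cubic u t Y W (chr u t X Z)
      - cubic u t Y Z (chr u t X W) := by
  rw [covCubic, hu.cubic_rotate ht (chr u t X Y), hu.cubic_swap_right ht Y (chr u t X Z)]

theorem contDiffOn_covCubic (hu : IsLagrangianOn u O) (X Y Z W : E3) :
    ContDiffOn ℝ ∞ (fun s => covCubic u s X Y Z W) O :=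
  ((((contDiffOn_fderiv_apply hu.isOpen (hu.contDiffOn_cubic Y Z W) contDiffOn_const).sub
    (hu.contDiffOn_cubic_field (hu.contDiffOn_chr X Y) Z W)).sub
    (hu.contDiffOn_cubic_field (hu.contDiffOn_chr X Z) Y W)).sub
    (hu.contDiffOn_cubic_field (hu.contDiffOn_chr X W) Y Z)).congr fun _ hs =>
    hu.covCubic_eq_chr_right hs X Y Z W

theorem fderiv_cubic_field (hu : IsLagrangianOn u O) (ht : t ∈ O) {A : E3 → E3}
    (hA : ContDiffOn ℝ ∞ A O) (X Y Z : E3) :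
    fderiv ℝ (fun s => cubic u s Y Z (A s)) t X = covCubic u t X Y Z (A t)
      + cubic u t Z (A t) (chr u t X Y) + cubic u t Y (A t) (chr u t X Z)
      + cubic u t Y Z (conn u A t X) := by
  have deriv_const := hu.fderiv_g_J_const (hu.isNormalField_h Y Z) ht X (A t)
  have deriv_field := hu.fderiv_g_J (hu.isNormalField_h Y Z) ht hA X
  rw [hu.covCubic_eq_chr_right ht, hu.conn_eq ht hA, cubic_add_right]
  simp only [cubic] at deriv_const deriv_field ⊢
  linarith

theorem fderiv_covCubic (hu : IsLagrangianOn u O) (ht : t ∈ O) (X Y Z W V : E3) :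
    fderiv ℝ (fun s => covCubic u s Y Z W V) t X =
      fderiv ℝ (fun s => fderiv ℝ (fun s => cubic u s Z W V) s Y) t X
      - fderiv ℝ (fun s => cubic u s W V (chr u s Y Z)) t X
      - fderiv ℝ (fun s => cubic u s Z V (chr u s Y W)) t X
      - fderiv ℝ (fun s => cubic u s Z W (chr u s Y V)) t X := by
  have diff_fderiv := differentiableAt_of_contDiffOn hu.isOpen (contDiffOn_fderiv_apply hu.isOpen
    (hu.contDiffOn_cubic Z W V) (contDiffOn_const (c := Y))) ht
  have diff_chr (A B C : E3) : DifferentiableAt ℝ (fun s => cubic u s A B (chr u s Y C)) t :=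
    differentiableAt_of_contDiffOn hu.isOpen
      (hu.contDiffOn_cubic_field (hu.contDiffOn_chr Y C) A B) ht
  rw [fderiv_congr_of_eqOn hu.isOpen (fun s hs => hu.covCubic_eq_chr_right hs Y Z W V) ht,
    fderiv_fun_sub ((diff_fderiv.fun_sub (diff_chr _ _ _)).fun_sub (diff_chr _ _ _))
      (diff_chr _ _ _),
    fderiv_fun_sub (diff_fderiv.fun_sub (diff_chr _ _ _)) (diff_chr _ _ _),
    fderiv_fun_sub diff_fderiv (diff_chr _ _ _)]
  simp only [_root_.sub_apply]

theorem cov2Cubic_sub_swap (hu : IsLagrangianOn u O) (ht : t ∈ O) (X Y Z W V : E3) :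
    cov2Cubic u t X Y Z W V - cov2Cubic u t Y X Z W V =
      -cubic u t W V (curv u t X Y Z) - cubic u t Z V (curv u t X Y W)
      - cubic u t Z W (curv u t X Y V) := by
  have cubic_curv (A B C : E3) : cubic u t A B (curv u t X Y C) =
      cubic u t A B (conn u (fun s => chr u s Y C) t X)
      - cubic u t A B (conn u (fun s => chr u s X C) t Y) := by
    rw [eq_sub_iff_add_eq, ← cubic_add_right]
    exact congrArg _ (sub_add_cancel _ _)
  have covCubic_rotate (A B C D : E3) : covCubic u t A B C D = covCubic u t A C D B := by
    rw [hu.covCubic_swap_left ht, hu.covCubic_swap_right ht]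
  simp only [cov2Cubic, hu.fderiv_covCubic ht, cubic_curv,
    hu.fderiv_cubic_field ht (hu.contDiffOn_chr _ _),
    fderiv_fderiv_comm hu.isOpen (hu.contDiffOn_cubic Z W V) ht X Y, hu.chr_comm ht Y X,
    covCubic_rotate _ (chr _ _ _ _) W V, hu.covCubic_swap_right ht _ Z (chr _ _ _ _) V]
  linarith [hu.cubic_swap_right ht V (chr u t Y Z) (chr u t X W),
    hu.cubic_swap_right ht V (chr u t X Z) (chr u t Y W),
    hu.cubic_swap_right ht W (chr u t Y Z) (chr u t X V),
    hu.cubic_swap_right ht W (chr u t X Z) (chr u t Y V),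
    hu.cubic_swap_right ht Z (chr u t Y W) (chr u t X V),
    hu.cubic_swap_right ht Z (chr u t X W) (chr u t Y V)]

theorem covCubic_sub_swap (hu : IsLagrangianOn u O) (ht : t ∈ O) (X Y Z W : E3) :
    3 * (covCubic u t X Y Z W - covCubic u t Y X Z W) =
      formP u t Y Z * formPJ u t X W - formP u t X Z * formPJ u t Y W
      - formPJ u t Y Z * formP u t X W + formPJ u t X Z * formP u t Y W
      + 3 * (formHG u t Y Z X W - formHG u t X Z Y W) := by
  have hS := hu.onS t ht
  have curv_normal := hu.g_curvS ht X Y Z (hu.isNormal_J ht W)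
  rw [← hu.codazzi ht X Y Z (hu.isNormal_J ht W)] at curv_normal
  simp only [g_P_J hS, g_PJ_J hS] at curv_normal
  rw [hu.covCubic_eq ht, hu.covCubic_eq ht]
  simp only [formP, formPJ] at curv_normal ⊢
  linarith

end IsLagrangianOn

/-! ### `J`-isotropic Lagrangian immersions -/

/-- `S` is a symmetric form of degree four on an abelian group, additive in each argument. -/
structure IsSymmQuartic {E F : Type*} [AddCommGroup E] [AddCommGroup F] (S : E → E → E → E → F) :
    Prop where
  add_right : ∀ a b c d d', S a b c (d + d') = S a b c d + S a b c d'
  swap_left : ∀ a b c d, S a b c d = S b a c d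
  swap_mid : ∀ a b c d, S a b c d = S a c b d
  swap_right : ∀ a b c d, S a b c d = S a b d c

namespace IsSymmQuartic

section Additive

variable {E F : Type*} [AddCommGroup E] [AddCommGroup F] {S : E → E → E → E → F}

theorem add_third (hS : IsSymmQuartic S) (a b c c' d : E) :
    S a b (c + c') d = S a b c d + S a b c' d := by
  simp only [hS.swap_right a b _ d, hS.add_right]

theorem add_second (hS : IsSymmQuartic S) (a b b' c d : E) :
    S a (b + b') c d = S a b c d + S a b' c d := by
  simp only [hS.swap_mid a _ c d, hS.add_third]

theorem add_first (hS : IsSymmQuartic S) (a a' b c d : E) :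
    S (a + a') b c d = S a b c d + S a' b c d := by
  simp only [hS.swap_left _ b c d, hS.add_second]

theorem neg_right (hS : IsSymmQuartic S) (a b c d : E) : S a b c (-d) = -S a b c d :=
  (AddMonoidHom.mk' (S a b c) (hS.add_right a b c)).map_neg d

theorem neg_third (hS : IsSymmQuartic S) (a b c d : E) : S a b (-c) d = -S a b c d := by
  simp only [hS.swap_right a b _ d, hS.neg_right]

theorem neg_second (hS : IsSymmQuartic S) (a b c d : E) : S a (-b) c d = -S a b c d := by
  simp only [hS.swap_mid a _ c d, hS.neg_third]

theorem neg_first (hS : IsSymmQuartic S) (a b c d : E) : S (-a) b c d = -S a b c d := by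
  simp only [hS.swap_left _ b c d, hS.neg_second]

end Additive

variable {E 𝕜 : Type*} [AddCommGroup E] [Field 𝕜] [CharZero 𝕜] {S : E → E → E → E → 𝕜}

theorem apply_pair_eq_zero (hS : IsSymmQuartic S) (h0 : ∀ v, S v v v v = 0) (a b : E) :
    S a a b b = 0 := by
  have at_add := h0 (a + b)
  have at_sub := h0 (a + -b)
  simp only [hS.add_first, hS.add_second, hS.add_third, hS.add_right, hS.neg_first, hS.neg_second,
    hS.neg_third, hS.neg_right, h0] at at_add at_sub
  have abab : S a b a b = S a a b b := hS.swap_mid a b a b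
  have abba : S a b b a = S a a b b := (hS.swap_right a b b a).trans abab
  have baba : S b a b a = S a a b b := (hS.swap_left b a b a).trans abba
  have baab : S b a a b = S a a b b := (hS.swap_right b a a b).trans baba
  have bbaa : S b b a a = S a a b b := (hS.swap_mid b b a a).trans baba
  linear_combination (at_add + at_sub) / 12 - (abab + abba + baba + baab + bbaa) / 6

theorem eq_zero (hS : IsSymmQuartic S) (h0 : ∀ v, S v v v v = 0) (a b c d : E) :
    S a b c d = 0 := by
  have left_diag (a c d : E) : S a a c d = 0 := by
    have expand := hS.apply_pair_eq_zero h0 a (c + d)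
    simp only [hS.add_third, hS.add_right, hS.apply_pair_eq_zero h0] at expand
    linear_combination expand / 2 + hS.swap_right a a c d / 2
  have expand := left_diag (a + b) c d
  simp only [hS.add_first, hS.add_second, left_diag] at expand
  linear_combination expand / 2 + hS.swap_left a b c d / 2

end IsSymmQuartic

/-- The immersion parametrized by `u` is `J`-isotropic with function `l`. -/
def IsJIsotropicOn (u : E3 → HH) (O : Set E3) (l : E3 → ℝ) : Prop :=
  ∀ s ∈ O, ∀ v, g (u s) (nablaH u s v v v) (J (u s) (fderiv ℝ u s v)) = l s * metr u s v v ^ 2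

/-- The summand of the formula for `12 (∇_Y C)(Z, W, V)` quadratic in `g`, `g(P ·, ·)` and
`g(PJ ·, ·)`, before the cyclic sum over `Z`, `W`, `V`. -/
def quadPart (u : E3 → HH) (l : E3 → ℝ) (t Y Z W V : E3) : ℝ :=
  4 * l t * (metr u t Y Z * metr u t W V) - 2 * (formP u t Y Z * formPJ u t W V)
    + 2 * (formPJ u t Y Z * formP u t W V)

/-- The covariant derivative `(∇_X g(P ·, ·))(Y, Z)` of the restriction of `g(P ·, ·)`. -/
def covFormP (u : E3 → HH) (t X Y Z : E3) : ℝ :=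
  g (u t) (P (u t) (fderiv ℝ u t Y)) (h u t X Z)
    + g (u t) (covDeriv P (u t) (fderiv ℝ u t X) (fderiv ℝ u t Y) + P (u t) (h u t X Y))
      (fderiv ℝ u t Z)

/-- The covariant derivative `(∇_X g(PJ ·, ·))(Y, Z)` of the restriction of `g(PJ ·, ·)`. -/
def covFormPJ (u : E3 → HH) (t X Y Z : E3) : ℝ :=
  g (u t) (PJ (u t) (fderiv ℝ u t Y)) (h u t X Z)
    + g (u t) (covDeriv PJ (u t) (fderiv ℝ u t X) (fderiv ℝ u t Y) + PJ (u t) (h u t X Y))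
      (fderiv ℝ u t Z)

/-- The covariant derivative along `X` of the tensor `g(h(Y, Z), G(W, V))`. -/
def covFormHG (u : E3 → HH) (t X Y Z W V : E3) : ℝ :=
  g (u t) (nablaH u t X Y Z) (G (u t) (fderiv ℝ u t W) (fderiv ℝ u t V))
    + 1 / 3 * (metr u t X V * cubic u t Y Z W - metr u t X W * cubic u t Y Z V)

/-- The covariant derivative along `X` of `quadPart`. -/
def covQuadPart (u : E3 → HH) (l : E3 → ℝ) (t X Y Z W V : E3) : ℝ :=
  4 * fderiv ℝ l t X * (metr u t Y Z * metr u t W V)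
    - 2 * (covFormP u t X Y Z * formPJ u t W V + formP u t Y Z * covFormPJ u t X W V)
    + 2 * (covFormPJ u t X Y Z * formP u t W V + formPJ u t Y Z * covFormP u t X W V)

theorem metr_add_right (u : E3 → HH) (t X Y Y' : E3) :
    metr u t X (Y + Y') = metr u t X Y + metr u t X Y' := by
  simp only [metr, map_add, g_add_right]

namespace IsMapOn

variable {u : E3 → HH} {O : Set E3} {t : E3}

theorem formP_comm (hu : IsMapOn u O) (ht : t ∈ O) (X Y : E3) :
    formP u t X Y = formP u t Y X := by
  rw [formP, g_P_left (hu.onS t ht), g_comm, formP]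

theorem formPJ_comm (hu : IsMapOn u O) (ht : t ∈ O) (X Y : E3) :
    formPJ u t X Y = formPJ u t Y X := by
  rw [formPJ, g_PJ_left (hu.onS t ht), g_comm, formPJ]

theorem formHG_comm (hu : IsMapOn u O) (ht : t ∈ O) (X Y Z W : E3) :
    formHG u t X Y Z W = formHG u t Y X Z W := by
  rw [formHG, hu.h_comm ht, formHG]

theorem formHG_antisymm (hu : IsMapOn u O) (ht : t ∈ O) (X Y Z W : E3) :
    formHG u t X Y Z W = -formHG u t X Y W Z := by
  rw [formHG, G_antisymm (hu.onS t ht) (hu.isTangent_fderiv ht Z) (hu.isTangent_fderiv ht W),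
    g_neg_right, formHG]

theorem contDiffOn_metr (hu : IsMapOn u O) (X Y : E3) :
    ContDiffOn ℝ ∞ (fun s => metr u s X Y) O :=
  hu.contDiffOn_g (hu.isField_fderiv_const X) (hu.isField_fderiv_const Y)

theorem contDiffOn_formP (hu : IsMapOn u O) (X Y : E3) :
    ContDiffOn ℝ ∞ (fun s => formP u s X Y) O :=
  hu.contDiffOn_g (hu.isField_P (hu.isField_fderiv_const X)) (hu.isField_fderiv_const Y)

theorem contDiffOn_formPJ (hu : IsMapOn u O) (X Y : E3) :
    ContDiffOn ℝ ∞ (fun s => formPJ u s X Y) O :=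
  hu.contDiffOn_g (hu.isField_PJ (hu.isField_fderiv_const X)) (hu.isField_fderiv_const Y)

theorem fderiv_formP (hu : IsMapOn u O) (ht : t ∈ O) (X Y Z : E3) :
    fderiv ℝ (fun s => formP u s Y Z) t X =
      formP u t (chr u t X Y) Z + formP u t Y (chr u t X Z) + covFormP u t X Y Z := by
  have hY := hu.isField_fderiv_const Y
  simp only [formP, covFormP, hu.fderiv_g (hu.isField_P hY) (hu.isField_fderiv_const Z) ht,
    hu.nabla_P hY ht, nabla_fderiv_const, P_add, g_add_left, g_add_right]
  ring

theorem fderiv_formPJ (hu : IsMapOn u O) (ht : t ∈ O) (X Y Z : E3) :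
    fderiv ℝ (fun s => formPJ u s Y Z) t X =
      formPJ u t (chr u t X Y) Z + formPJ u t Y (chr u t X Z) + covFormPJ u t X Y Z := by
  have hY := hu.isField_fderiv_const Y
  simp only [formPJ, covFormPJ, hu.fderiv_g (hu.isField_PJ hY) (hu.isField_fderiv_const Z) ht,
    hu.nabla_PJ hY ht, nabla_fderiv_const, PJ_add, g_add_left, g_add_right]
  ring

end IsMapOn

namespace IsImmersionOn

variable {u : E3 → HH} {O : Set E3} {t : E3} {l : E3 → ℝ}

theorem contDiffOn_formHG (hu : IsImmersionOn u O) (X Y Z W : E3) :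
    ContDiffOn ℝ ∞ (fun s => formHG u s X Y Z W) O :=
  hu.contDiffOn_g (hu.isField_h X Y)
    (hu.isField_G (hu.isField_fderiv_const Z) (hu.isField_fderiv_const W))

theorem fderiv_metr (hu : IsImmersionOn u O) (ht : t ∈ O) (X Y Z : E3) :
    fderiv ℝ (fun s => metr u s Y Z) t X = metr u t (chr u t X Y) Z + metr u t Y (chr u t X Z) := by
  simp only [metr, hu.fderiv_g (hu.isField_fderiv_const Y) (hu.isField_fderiv_const Z) ht,
    nabla_fderiv_const, g_add_left, g_add_right, (hu.isNormal_h ht X Y).g_eq_zero,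
    (hu.isNormal_h ht X Z).g_fderiv_left, add_zero]

theorem contDiffOn_quadPart (hu : IsImmersionOn u O) (hl : ContDiffOn ℝ ∞ l O) (Y Z W V : E3) :
    ContDiffOn ℝ ∞ (fun s => quadPart u l s Y Z W V) O :=
  (((contDiffOn_const.mul hl).mul ((hu.contDiffOn_metr Y Z).mul (hu.contDiffOn_metr W V))).sub
    (contDiffOn_const.mul ((hu.contDiffOn_formP Y Z).mul (hu.contDiffOn_formPJ W V)))).add
    (contDiffOn_const.mul ((hu.contDiffOn_formPJ Y Z).mul (hu.contDiffOn_formP W V)))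

theorem fderiv_quadPart (hu : IsImmersionOn u O) (hl : ContDiffOn ℝ ∞ l O) (ht : t ∈ O)
    (X Y Z W V : E3) :
    fderiv ℝ (fun s => quadPart u l s Y Z W V) t X =
      quadPart u l t (chr u t X Y) Z W V + quadPart u l t Y (chr u t X Z) W V
      + quadPart u l t Y Z (chr u t X W) V + quadPart u l t Y Z W (chr u t X V)
      + covQuadPart u l t X Y Z W V := by
  have hasFDerivAt {f : E3 → ℝ} (hf : ContDiffOn ℝ ∞ f O) :=
    hasFDerivAt_of_contDiffOn hu.isOpen hf ht
  have deriv_metr (A B : E3) := hasFDerivAt (hu.contDiffOn_metr A B)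
  have deriv_formP (A B : E3) := hasFDerivAt (hu.contDiffOn_formP A B)
  have deriv_formPJ (A B : E3) := hasFDerivAt (hu.contDiffOn_formPJ A B)
  have product_rule :=
    ((((hasFDerivAt hl).const_mul 4).fun_mul ((deriv_metr Y Z).fun_mul (deriv_metr W V))).fun_sub
      (((deriv_formP Y Z).fun_mul (deriv_formPJ W V)).const_mul 2)).fun_add
      (((deriv_formPJ Y Z).fun_mul (deriv_formP W V)).const_mul 2)
  simp only [quadPart, product_rule.fderiv, _root_.add_apply, _root_.sub_apply,
    _root_.smul_apply, smul_eq_mul, hu.fderiv_metr ht, hu.fderiv_formP ht, hu.fderiv_formPJ ht,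
    covQuadPart]
  ring

theorem two_mul_termI (hu : IsImmersionOn u O) (ht : t ∈ O) (X Y Z W V : E3) :
    2 * termI u l t X Y Z W V =
      cyc3 (covQuadPart u l t Y X) Z W V - cyc3 (covQuadPart u l t X Y) Z W V := by
  simp only [termI, cyc3, covQuadPart, covFormP, covFormPJ, formP, formPJ, metr, hu.h_comm ht Y X]
  ring

end IsImmersionOn

namespace IsLagrangianOn

variable {u : E3 → HH} {O : Set E3} {t : E3} {l : E3 → ℝ}

theorem fderiv_formHG (hu : IsLagrangianOn u O) (ht : t ∈ O) (X Y Z W V : E3) :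
    fderiv ℝ (fun s => formHG u s Y Z W V) t X =
      formHG u t (chr u t X Y) Z W V + formHG u t Y (chr u t X Z) W V
      + formHG u t Y Z (chr u t X W) V + formHG u t Y Z W (chr u t X V)
      + covFormHG u t X Y Z W V := by
  simp only [formHG, covFormHG, cubic, hu.fderiv_g_G (hu.isNormalField_h Y Z) ht, nablaH_eq,
    g_sub_left]
  ring

theorem covCubic_diag (hu : IsLagrangianOn u O) (hl : IsJIsotropicOn u O l) (ht : t ∈ O) (v : E3) :
    covCubic u t v v v v = l t * metr u t v v ^ 2 := by
  rw [hu.covCubic_eq ht, hl t ht, add_eq_left]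
  exact self_eq_neg.1 (hu.formHG_antisymm ht v v v v)

theorem contDiffOn_of_isJIsotropicOn (hu : IsLagrangianOn u O) (hl : IsJIsotropicOn u O l) :
    ContDiffOn ℝ ∞ l O := by
  obtain ⟨v, hv⟩ := exists_ne (0 : E3)
  have metr_sq_ne_zero : ∀ s ∈ O, metr u s v v ^ 2 ≠ 0 := fun s hs =>
    pow_ne_zero 2 fun h => hv (hu.eq_zero_of_g_fderiv_self hs h)
  refine ((hu.contDiffOn_covCubic v v v v).div ((hu.contDiffOn_metr v v).pow 2)
    metr_sq_ne_zero).congr fun s hs => ?_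
  rw [Pi.div_apply, eq_div_iff (metr_sq_ne_zero s hs), hu.covCubic_diag hl hs]

theorem covCubic_polarized (hu : IsLagrangianOn u O) (hl : IsJIsotropicOn u O l) (ht : t ∈ O)
    (X Y Z W : E3) :
    covCubic u t X Y Z W + covCubic u t Y X Z W + covCubic u t Z X Y W + covCubic u t W X Y Z =
      4 / 3 * l t * (metr u t X Y * metr u t Z W + metr u t X Z * metr u t Y W
        + metr u t X W * metr u t Y Z) := by
  have swap_left := hu.covCubic_swap_left ht
  have swap_right := hu.covCubic_swap_right ht
  have comm := metr_comm u t
  have symmQuartic : IsSymmQuartic fun X Y Z W =>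
      covCubic u t X Y Z W + covCubic u t Y X Z W + covCubic u t Z X Y W + covCubic u t W X Y Z -
        4 / 3 * l t * (metr u t X Y * metr u t Z W + metr u t X Z * metr u t Y W
          + metr u t X W * metr u t Y Z) :=
    { add_right := fun a b c d d' => by
        simp only [hu.covCubic_add_right ht, hu.covCubic_add_left ht, metr_add_right]
        ring
      swap_left := fun a b c d => by rw [swap_left c a b d, swap_left d a b c, comm a b]; ring
      swap_mid := fun a b c d => by rw [swap_left a b c d, swap_right d a b c, comm b c]; ring
      swap_right := fun a b c d => by rw [swap_right a b c d, swap_right b a c d, comm c d]; ring }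
  exact sub_eq_zero.1 <| symmQuartic.eq_zero
    (fun v => by simp only [hu.covCubic_diag hl ht]; ring) X Y Z W

/-- Codazzi turns the three other terms of the polarized isotropy condition into
`(∇_Y C)(Z, W, V)`, up to `g(P ·, ·)`, `g(PJ ·, ·)` and `g(h, G)`. -/
theorem twelve_mul_covCubic (hu : IsLagrangianOn u O) (hl : IsJIsotropicOn u O l) (ht : t ∈ O)
    (Y Z W V : E3) :
    12 * covCubic u t Y Z W V = cyc3 (quadPart u l t Y) Z W V
      + 9 * formHG u t Z W Y V - 3 * formHG u t Y Z W V - 3 * formHG u t Y W Z V := by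
  have swap_left := hu.covCubic_swap_left ht
  have swap_right := hu.covCubic_swap_right ht
  have polarized := hu.covCubic_polarized hl ht Y Z W V
  have swap_YZ := hu.covCubic_sub_swap ht Y Z W V
  have swap_YW := hu.covCubic_sub_swap ht Y W Z V
  have swap_YV := hu.covCubic_sub_swap ht Y V Z W
  have cyclic := hu.formHG_cyclic ht Z V Y W
  rw [hu.formP_comm ht Z V, hu.formPJ_comm ht Z V] at swap_YZ
  rw [hu.formP_comm ht W Z, hu.formPJ_comm ht W Z, hu.formHG_comm ht W Z, swap_left Y W Z V]
    at swap_YW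
  rw [hu.formP_comm ht V W, hu.formPJ_comm ht V W, hu.formHG_comm ht V Z,
    hu.formHG_antisymm ht Y Z V W, swap_right Y V Z W, swap_left Y V W Z, swap_right Y W V Z,
    swap_left Y W Z V] at swap_YV
  rw [hu.formHG_comm ht Z Y, hu.formHG_antisymm ht Z W V Y] at cyclic
  simp only [cyc3, quadPart, metr_comm u t V Z]
  linear_combination 3 * polarized + swap_YZ + swap_YW + swap_YV + 3 * cyclic

theorem twelve_mul_cov2Cubic (hu : IsLagrangianOn u O) (hl : IsJIsotropicOn u O l)
    (ht : t ∈ O) (X Y Z W V : E3) :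
    12 * cov2Cubic u t X Y Z W V = cyc3 (covQuadPart u l t X Y) Z W V
      + 9 * covFormHG u t X Z W Y V - 3 * covFormHG u t X Y Z W V
      - 3 * covFormHG u t X Y W Z V := by
  have first := fun {s : E3} (hs : s ∈ O) (Y Z W V : E3) => hu.twelve_mul_covCubic hl hs Y Z W V
  have hasFDerivAt {f : E3 → ℝ} (hf : ContDiffOn ℝ ∞ f O) :=
    hasFDerivAt_of_contDiffOn hu.isOpen hf ht
  have deriv_quadPart (A B C : E3) := hasFDerivAt
    (hu.contDiffOn_quadPart (hu.contDiffOn_of_isJIsotropicOn hl) Y A B C)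
  have deriv_formHG (A B C D : E3) := hasFDerivAt (hu.contDiffOn_formHG A B C D)
  have deriv_rhs := (((((deriv_quadPart Z W V).fun_add (deriv_quadPart W V Z)).fun_add
    (deriv_quadPart V Z W)).fun_add ((deriv_formHG Z W Y V).const_mul 9)).fun_sub
    ((deriv_formHG Y Z W V).const_mul 3)).fun_sub ((deriv_formHG Y W Z V).const_mul 3)
  have deriv_lhs := (hasFDerivAt (hu.contDiffOn_covCubic Y Z W V)).const_mul 12
  have deriv_eq := DFunLike.congr_fun (deriv_lhs.unique (deriv_rhs.congr_of_eventuallyEq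
    ((hu.eventually_mem ht).mono fun s hs => first hs Y Z W V))) X
  simp only [_root_.add_apply, _root_.sub_apply, _root_.smul_apply, smul_eq_mul,
    hu.fderiv_quadPart (hu.contDiffOn_of_isJIsotropicOn hl) ht, hu.fderiv_formHG ht] at deriv_eq
  have chr_Y := first ht (chr u t X Y) Z W V
  have chr_Z := first ht Y (chr u t X Z) W V
  have chr_W := first ht Y Z (chr u t X W) V
  have chr_V := first ht Y Z W (chr u t X V)
  simp only [cov2Cubic, cyc3] at chr_Y chr_Z chr_W chr_V ⊢
  linear_combination deriv_eq - chr_Y - chr_Z - chr_W - chr_V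

theorem isotropic_identity (hu : IsLagrangianOn u O) (hl : IsJIsotropicOn u O l)
    (ht : t ∈ O) (X Y Z W V : E3) :
    12 * g (u t) (normalCurv u (fun s => h u s Z W) t X Y
        - h u t (curv u t X Y Z) W - h u t Z (curv u t X Y W)) (J (u t) (fderiv ℝ u t V))
      + 9 * (g (u t) (nablaH u t Y Z W) (G (u t) (fderiv ℝ u t X) (fderiv ℝ u t V))
        - g (u t) (nablaH u t X Z W) (G (u t) (fderiv ℝ u t Y) (fderiv ℝ u t V)))
      + 3 * cubic u t Y Z W * metr u t X V - 3 * cubic u t X Z W * metr u t Y V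
      + cyc2 (fun Z W => cubic u t X Z V * metr u t Y W - cubic u t Y Z V * metr u t X W
          + formP u t Y Z * g (u t) (P (u t) (fderiv ℝ u t X))
            (G (u t) (fderiv ℝ u t W) (fderiv ℝ u t V))
          - formP u t X Z * g (u t) (P (u t) (fderiv ℝ u t Y))
            (G (u t) (fderiv ℝ u t W) (fderiv ℝ u t V))
          + g (u t) (J (u t) (P (u t) (fderiv ℝ u t Y))) (fderiv ℝ u t Z) *
            g (u t) (J (u t) (P (u t) (fderiv ℝ u t X)))
              (G (u t) (fderiv ℝ u t W) (fderiv ℝ u t V))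
          - g (u t) (J (u t) (P (u t) (fderiv ℝ u t X))) (fderiv ℝ u t Z) *
            g (u t) (J (u t) (P (u t) (fderiv ℝ u t Y)))
              (G (u t) (fderiv ℝ u t W) (fderiv ℝ u t V))) Z W
      + 2 * termI u l t X Y Z W V = 0 := by
  have rotate (A : E3) : cubic u t Z W A = cubic u t A Z W := (hu.cubic_rotate ht A Z W).symm
  have swap (A : E3) : cubic u t A W Z = cubic u t A Z W := hu.cubic_swap_right ht A W Z
  have second_XY := hu.twelve_mul_cov2Cubic hl ht X Y Z W V
  have second_YX := hu.twelve_mul_cov2Cubic hl ht Y X Z W V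
  have ricci_identity := hu.cov2Cubic_sub_swap ht X Y Z W V
  have ricci : g (u t) (normalCurv u (fun s => h u s Z W) t X Y) (J (u t) (fderiv ℝ u t V)) =
      -cubic u t Z W (curv u t X Y V)
        - 1 / 3 * (metr u t X V * cubic u t Z W Y - metr u t Y V * cubic u t Z W X) :=
    hu.ricci (hu.isNormalField_h Z W) ht X Y V
  have codazzi_Z := hu.codazzi ht X Y Z (hu.isNormal_G ht W V)
  have codazzi_W := hu.codazzi ht X Y W (hu.isNormal_G ht Z V)
  have curv_Z := hu.g_curvS ht X Y Z (hu.isNormal_G ht W V)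
  have curv_W := hu.g_curvS ht X Y W (hu.isNormal_G ht Z V)
  have curv_Z_W : cubic u t (curv u t X Y Z) W V = cubic u t W V (curv u t X Y Z) :=
    hu.cubic_rotate ht _ W V
  have curv_W_Z : cubic u t Z (curv u t X Y W) V = cubic u t Z V (curv u t X Y W) :=
    hu.cubic_swap_right ht Z _ V
  simp only [covFormHG, rotate, swap, metr_comm u t Y X] at second_XY second_YX ricci_identity ricci
  simp only [formPJ] at curv_Z curv_W
  simp only [hu.two_mul_termI ht, cyc2, J_P (hu.onS t ht), g_neg_left, g_sub_left]
  rw [cubic] at curv_Z_W curv_W_Z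
  linear_combination second_XY - second_YX - 12 * ricci_identity + 12 * ricci - 12 * curv_Z_W
    - 12 * curv_W_Z - 3 * codazzi_Z - 3 * codazzi_W - curv_Z - curv_W

end IsLagrangianOn

/-! ### Passing to charts -/

/-- The inclusion of `𝕊³ × 𝕊³` in `ℍ × ℍ`. -/
def inclHH : S3 × S3 → HH := Prod.map (↑) (↑)

theorem contMDiff_inclHH : ContMDiff ((𝓡 3).prod (𝓡 3)) 𝓘(ℝ, HH) ∞ inclHH :=
  (contMDiff_coe_sphere.comp contMDiff_fst).prodMk_space (contMDiff_coe_sphere.comp contMDiff_snd)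

theorem mfderiv_inclHH (y : S3 × S3) : mfderiv ((𝓡 3).prod (𝓡 3)) 𝓘(ℝ, HH) inclHH y =
    (mfderiv (𝓡 3) 𝓘(ℝ, ℍ[ℝ]) ((↑) : S3 → ℍ[ℝ]) y.1).prodMap
      (mfderiv (𝓡 3) 𝓘(ℝ, ℍ[ℝ]) ((↑) : S3 → ℍ[ℝ]) y.2) := by
  have mdifferentiableAt_coe (v : S3) :
      MDifferentiableAt (𝓡 3) 𝓘(ℝ, ℍ[ℝ]) ((↑) : S3 → ℍ[ℝ]) v :=
    contMDiff_coe_sphere.mdifferentiableAt (n := 1) one_ne_zero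
  rw [modelWithCornersSelf_prod, ← chartedSpaceSelf_prod]
  exact mfderiv_prodMap (mdifferentiableAt_coe _) (mdifferentiableAt_coe _)

theorem mfderiv_inclHH_injective (y : S3 × S3) :
    Function.Injective (mfderiv ((𝓡 3).prod (𝓡 3)) 𝓘(ℝ, HH) inclHH y) := by
  have mfderiv_coe_injective (v : S3) :
      Function.Injective (mfderiv (𝓡 3) 𝓘(ℝ, ℍ[ℝ]) ((↑) : S3 → ℍ[ℝ]) v) :=
    injective_mvfderiv_subtypeVal_sphere v
  rw [mfderiv_inclHH]
  exact (mfderiv_coe_injective _).prodMap (mfderiv_coe_injective _)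

section Charts

variable {M : Type*} [TopologicalSpace M] [ChartedSpace E3 M] {f : M → S3 × S3}

theorem IsSmoothImmersion.contMDiff_toHH (hf : IsSmoothImmersion f) :
    ContMDiff (𝓡 3) 𝓘(ℝ, HH) ∞ (toHH f) := contMDiff_inclHH.comp hf.1

theorem IsSmoothImmersion.mfderiv_toHH_injective (hf : IsSmoothImmersion f) (p : M) :
    Function.Injective (mfderiv (𝓡 3) 𝓘(ℝ, HH) (toHH f) p) := by
  have chain_rule : mfderiv (𝓡 3) 𝓘(ℝ, HH) (toHH f) p =
      (mfderiv ((𝓡 3).prod (𝓡 3)) 𝓘(ℝ, HH) inclHH (f p)).comp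
        (mfderiv (𝓡 3) ((𝓡 3).prod (𝓡 3)) f p) :=
    mfderiv_comp p (contMDiff_inclHH.mdifferentiableAt (by simp)) (hf.1.mdifferentiableAt (by simp))
  rw [chain_rule]
  exact (mfderiv_inclHH_injective _).comp (hf.2 p)

variable [IsManifold (𝓡 3) ∞ M] {φ : OpenPartialHomeomorph M E3}

theorem IsSmoothImmersion.exists_fderiv_param (hf : IsSmoothImmersion f) (hφ : φ ∈ atlas E3 M)
    {t : E3} (ht : t ∈ φ.target) :
    ∃ e : E3 → TangentSpace (𝓡 3) (φ.symm t), Function.Bijective e ∧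
      ∀ X, fderiv ℝ (param f φ) t X = mfderiv (𝓡 3) 𝓘(ℝ, HH) (toHH f) (φ.symm t) (e X) := by
  have : IsManifold (𝓡 3) 1 M := .of_le (n := ∞) (by norm_cast)
  have mdifferentiable_φ := mdifferentiable_of_mem_atlas (I := 𝓡 3) hφ
  have chain_rule := mfderiv_comp (I := 𝓡 3) (I' := 𝓡 3) (I'' := 𝓘(ℝ, HH)) t (g := toHH f)
    (f := φ.symm) (hf.contMDiff_toHH.mdifferentiableAt (by simp))
    (mdifferentiable_φ.mdifferentiableAt_symm ht)
  refine ⟨mfderiv (𝓡 3) (𝓡 3) φ.symm t, mdifferentiable_φ.symm.mfderiv_bijective ht, fun X => ?_⟩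
  rw [← mfderiv_eq_fderiv]
  exact DFunLike.congr_fun chain_rule X

theorem isLagrangianOn_param (hf : IsSmoothImmersion f) (hL : IsLagrangian f)
    (hφ : φ ∈ atlas E3 M) : IsLagrangianOn (param f φ) φ.target where
  isOpen := φ.open_target
  smooth := (hf.contMDiff_toHH.comp_contMDiffOn (contMDiffOn_symm_of_mem_maximalAtlas
    (IsManifold.subset_maximalAtlas hφ))).contDiffOn
  onS s _ := ⟨norm_eq_of_mem_sphere _, norm_eq_of_mem_sphere _⟩
  injective s hs X Y hXY := by
    obtain ⟨e, he, fderiv_eq⟩ := hf.exists_fderiv_param hφ hs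
    rw [fderiv_eq, fderiv_eq] at hXY
    exact he.injective (hf.mfderiv_toHH_injective _ hXY)
  lagrangian s hs w hw := by
    obtain ⟨e, he, fderiv_eq⟩ := hf.exists_fderiv_param hφ hs
    simp only [fderiv_eq]
    exact (he.surjective.exists.symm.trans (hL (φ.symm s) w hw)).trans he.surjective.forall

theorem contMDiff_of_isJIsotropic (hf : IsSmoothImmersion f) (hL : IsLagrangian f) {lam : M → ℝ}
    (hJ : IsJIsotropic f lam) : ContMDiff (𝓡 3) 𝓘(ℝ, ℝ) ∞ lam := by
  intro p
  have hφ := chart_mem_atlas E3 p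
  have smooth_coord : ContDiffOn ℝ ∞ (lam ∘ (chartAt E3 p).symm) (chartAt E3 p).target :=
    (isLagrangianOn_param hf hL hφ).contDiffOn_of_isJIsotropicOn (hJ _ hφ)
  have smooth_comp := smooth_coord.contMDiffOn.comp (contMDiffOn_of_mem_maximalAtlas (I := 𝓡 3)
    (n := ∞) (IsManifold.subset_maximalAtlas hφ)) (chartAt E3 p).mapsTo
  exact (smooth_comp.congr fun q hq => congrArg lam ((chartAt E3 p).left_inv hq).symm).contMDiffAt
    (chart_source_mem_nhds E3 p)

end Charts

end NK

end

open NK in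
theorem proposition4p2 {M : Type*} [TopologicalSpace M] [ChartedSpace E3 M]
    [IsManifold (𝓡 3) ∞ M] (f : M → S3 × S3) (hf : IsSmoothImmersion f) (hL : IsLagrangian f)
    (lam : M → ℝ) (hJ : IsJIsotropic f lam) :
    ContMDiff (𝓡 3) 𝓘(ℝ, ℝ) ∞ lam ∧
    ∀ φ ∈ atlas E3 M, ∀ t ∈ φ.target, ∀ X Y Z W V : E3,
      let u : E3 → HH := param f φ
      let x : HH := u t
      let d : E3 → HH := fun A => fderiv ℝ u t A
      let Gd : E3 → E3 → HH := fun A B => G x (d A) (d B)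
      12 * g x (normalCurv u (fun s => h u s Z W) t X Y
            - h u t (curv u t X Y Z) W - h u t Z (curv u t X Y W)) (J x (d V))
        + 9 * (g x (nablaH u t Y Z W) (Gd X V) - g x (nablaH u t X Z W) (Gd Y V))
        + 3 * g x (h u t Y Z) (J x (d W)) * g x (d X) (d V)
        - 3 * g x (h u t X Z) (J x (d W)) * g x (d Y) (d V)
        + cyc2 (fun Z W =>
            g x (h u t X Z) (J x (d V)) * g x (d Y) (d W)
            - g x (h u t Y Z) (J x (d V)) * g x (d X) (d W)
            + g x (P x (d Y)) (d Z) * g x (P x (d X)) (Gd W V)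
            - g x (P x (d X)) (d Z) * g x (P x (d Y)) (Gd W V)
            + g x (J x (P x (d Y))) (d Z) * g x (J x (P x (d X))) (Gd W V)
            - g x (J x (P x (d X))) (d Z) * g x (J x (P x (d Y))) (Gd W V)) Z W
        + 2 * termI u (lam ∘ φ.symm) t X Y Z W V = 0 :=
  ⟨contMDiff_of_isJIsotropic hf hL hJ, fun _ hφ _ ht X Y Z W V =>
    (isLagrangianOn_param hf hL hφ).isotropic_identity (hJ _ hφ) ht X Y Z W V⟩
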